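/- **Setting.** Let $\Delta$ be a connectivity complex with vertex set $V=\{1,\dots,N_V\}$, i.e. a non-empty abstract simplicial complex (all singletons of $V$ are faces) which is pure of dimension $2$ (every face is contained in a $2$-face) and $2$-path connected (any two $2$-faces are joined by a finite sequence of $2$-faces in which consecutive ones intersect in a $1$-face). Let $\Delta$ be oriented: its $2$-faces are numbered $1,\dots,N_T$ and the $k$-th one has ordered vertices $(i_0^k,i_1^k,i_2^k)$. For $Q=[q_1,\dots,q_{N_V}]\in\mathbb R^{2\times N_V}$ put $$A_Q(i_0,i_1,i_2)=\tfrac12\det[\,q_{i_1}-q_{i_0},\;q_{i_2}-q_{i_1}],\qquad E_Q^\ell(i_0,i_1,i_2)=\|q_{i_{\ell\oplus1}}-q_{i_{\ell\oplus2}}\|,\qquad h_Q^\ell=\frac{2A_Q}{E_Q^\ell}\qquad(\ell=0,1,2),$$ where $\oplus$ is addition modulo $3$. Let $\mathcal M_+$ be the set of all $Q$ such that the sets $\operatorname{conv}\{q_i: i\in\sigma\}$, $\sigma\in\Delta$, form a geometric simplicial complex in $\mathbb R^2$ with connectivity $\Delta$ (in particular, distinct vertices have distinct positions) and $A_Q(i_0^k,i_1^k,i_2^k)>0$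 for all $k$. Fix a reference mesh $Q_{\mathrm{ref}}\in\mathcal M_+$ and let the manifold of planar triangular meshes $\mathcal M_0$ be the set of all $Q\in\mathcal M_+$ that can be joined to $Q_{\mathrm{ref}}$ by a continuous path inside $\mathcal M_+$. A boundary edge is a $1$-face contained in exactly one $2$-face, and a boundary vertex is a vertex of a boundary edge. Let $E_\partial$ be the set of boundary edges $[j_0,j_1]$, each oriented as in the oriented triangle that contains it, and let $V_\partial$ be the set of boundary vertices. Let $\|\cdot\|_{1,\mu}:\mathbb R^2\to\mathbb R$ be any function of class $C^3$ with $0\le\|x\|_{1,\mu}\le\|x\|_1$ for all $x$ and $\|x\|_{1,\mu}>0$ for $x\ne0$. For a vertex $i_0$ and an edge $[j_0,j_1]$ let $$D_Q(i_0;[j_0,j_1])=\min\bigl\{\|q_{i_0}-q\|_{1,\mu}: q\in\operatorname{conv}\{q_{j_0},q_{j_1}\}\bigr\},$$ where $\|\cdot\|_{1,\mu}$ is evaluated on coordinates in the positively oriented orthonormal frame whose first vector points from $q_{j_0}$ to $q_{j_1}$. With the Frobenius norm $\|\cdot\|_F$ and real numbers $\alpha_1,\dots,\alpha_4,\beta_1,\beta_2,\beta_3>0$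 define $$f_\mu(Q)=\sum_{k=1}^{N_T}\sum_{\ell=0}^2\frac{\beta_1}{h_Q^\ell(i_0^k,i_1^k,i_2^k)}+\sum_{[j_0,j_1]\in E_\partial}\ \sum_{\substack{i_0\in V_\partial\\ i_0\ne j_0,j_1}}\frac{\beta_2}{D_Q(i_0;[j_0,j_1])}+\frac{\beta_3}{2}\|Q-Q_{\mathrm{ref}}\|_F^2\qquad(Q\in\mathcal M_+),$$ $$\varphi(Q)=\sum_{k=1}^{N_T}\frac{\alpha_1}{N_T}\,\frac{\sum_{\ell=0}^2 E_Q^\ell(i_0^k,i_1^k,i_2^k)^2}{4\sqrt3\,A_Q(i_0^k,i_1^k,i_2^k)}+\frac{\alpha_2}{\sum_{k=1}^{N_T}A_Q(i_0^k,i_1^k,i_2^k)}+\sum_{[j_0,j_1]\in E_\partial}\ \sum_{\substack{i_0\in V_\partial\\ i_0\ne j_0,j_1}}\frac{1}{\#E_\partial\,\#V_\partial}\,\frac{\alpha_3}{D_Q(i_0;[j_0,j_1])}+\frac{\alpha_4}{2}\|Q-Q_{\mathrm{ref}}\|_F^2\qquad(Q\in\mathcal M_0).$$ **Theorem 3.4.**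 For every $b\in\mathbb R$ there is a constant $B>0$ such that $$\{Q\in\mathcal M_0:\varphi(Q)\le b\}\subseteq f_\mu^{-1}([0,B]).$$ Moreover, $\varphi:\mathcal M_0\to\mathbb R$ is proper (it is continuous and preimages of compact sets are compact), where $\mathcal M_0$ carries the topology induced from $\mathbb R^{2\times N_V}$. -/

import Mathlib

open scoped BigOperators RealInnerProductSpace

noncomputable section

namespace PlanarMesh

/-- The Euclidean plane `ℝ²`. -/
abbrev Plane : Type := EuclideanSpace ℝ (Fin 2)

/-- Vertex positions `Q ∈ ℝ^{2 × n}`: the `i`-th column of `Q` is `Q i`. The topology is the usual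
one of `ℝ^{2 × n}`. -/
abbrev Positions (n : ℕ) : Type := Fin n → Plane

/-! ### Connectivity -/

/-- The `2`-faces (triangles) of an abstract simplicial complex. -/
def twoFaces {n : ℕ} (Δ : AbstractSimplicialComplex (Fin n)) : Set (Finset (Fin n)) :=
  {σ | σ ∈ Δ.faces ∧ σ.card = 3}

/-- Two `2`-faces whose intersection is a `1`-face. -/
def EdgeAdjacent {n : ℕ} (Δ : AbstractSimplicialComplex (Fin n)) (σ τ : Finset (Fin n)) : Prop :=
  σ ∈ twoFaces Δ ∧ τ ∈ twoFaces Δ ∧ σ ∩ τ ∈ Δ.faces ∧ (σ ∩ τ).card = 2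

/-- A connectivity complex with vertex set `Fin n`: a non-empty, pure, `2`-path connected abstract
simplicial `2`-complex. (`AbstractSimplicialComplex` requires every singleton to be a face;
purity forces every face to have dimension at most two.) -/
structure IsConnectivityComplex {n : ℕ} (Δ : AbstractSimplicialComplex (Fin n)) : Prop where
  nonempty : Δ.faces.Nonempty
  pure : ∀ τ ∈ Δ.faces, ∃ σ ∈ twoFaces Δ, τ ⊆ σ
  twoPathConnected : ∀ σ ∈ twoFaces Δ, ∀ σ' ∈ twoFaces Δ,
    Relation.ReflTransGen (EdgeAdjacent Δ) σ σ'

/-- An orientation of `Δ`, given through a numbering of its `2`-faces: the `k`-th triangle has the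
ordered vertices `vert k 0, vert k 1, vert k 2`, and every `2`-face occurs exactly once. -/
structure OrientedTriangles {n : ℕ} (Δ : AbstractSimplicialComplex (Fin n)) (NT : ℕ) where
  vert : Fin NT → Fin 3 → Fin n
  bijOn : Set.BijOn (fun k => Finset.univ.image (vert k)) Set.univ (twoFaces Δ)

/-- A boundary edge is a `1`-face contained in exactly one `2`-face. -/
def IsBoundaryEdge {n : ℕ} (Δ : AbstractSimplicialComplex (Fin n)) (e : Finset (Fin n)) : Prop :=
  e ∈ Δ.faces ∧ e.card = 2 ∧ ∃! σ, σ ∈ twoFaces Δ ∧ e ⊆ σ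

/-- A boundary vertex is a vertex of a boundary edge. -/
def IsBoundaryVertex {n : ℕ} (Δ : AbstractSimplicialComplex (Fin n)) (i : Fin n) : Prop :=
  ∃ e, IsBoundaryEdge Δ e ∧ i ∈ e

open scoped Classical in
/-- The set `V_∂` of boundary vertices. -/
def boundaryVertices {n : ℕ} (Δ : AbstractSimplicialComplex (Fin n)) : Finset (Fin n) :=
  Finset.univ.filter (IsBoundaryVertex Δ)

open scoped Classical in
/-- The set `E_∂` of boundary edges `[j₀, j₁]`. Every boundary edge occurs exactly once, with the
orientation induced by the only triangle that contains it. -/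
def boundaryEdges {n NT : ℕ} {Δ : AbstractSimplicialComplex (Fin n)} (T : OrientedTriangles Δ NT) :
    Finset (Fin n × Fin n) :=
  Finset.univ.filter fun e =>
    IsBoundaryEdge Δ {e.1, e.2} ∧ ∃ k ℓ, T.vert k ℓ = e.1 ∧ T.vert k (ℓ + 1) = e.2

/-! ### Geometry -/

/-- `det [u, v]`. -/
def det₂ (u v : Plane) : ℝ := Matrix.det !![u 0, v 0; u 1, v 1]

/-- The signed area `A_Q(i₀, i₁, i₂)`, where `t 0, t 1, t 2` are the vertex numbers. -/
def signedArea {n : ℕ} (Q : Positions n) (t : Fin 3 → Fin n) : ℝ :=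
  1 / 2 * det₂ (Q (t 1) - Q (t 0)) (Q (t 2) - Q (t 1))

/-- The length of the `ℓ`-th edge, opposite the `ℓ`-th vertex (addition modulo 3 in `Fin 3`). -/
def edgeLength {n : ℕ} (Q : Positions n) (t : Fin 3 → Fin n) (ℓ : Fin 3) : ℝ :=
  ‖Q (t (ℓ + 1)) - Q (t (ℓ + 2))‖

/-- The `ℓ`-th height of a triangle. -/
def height {n : ℕ} (Q : Positions n) (t : Fin 3 → Fin n) (ℓ : Fin 3) : ℝ :=
  2 * signedArea Q t / edgeLength Q t ℓ

/-- The positions `Q` turn `Δ` into a geometric simplicial complex in the plane with connectivity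
`Δ`: the vertex sets `Q(σ)`, `σ ∈ Δ`, are the faces of a geometric simplicial complex, and distinct
vertices have distinct positions (so distinct faces of `Δ` give distinct simplices). -/
def IsGeometricComplex {n : ℕ} (Δ : AbstractSimplicialComplex (Fin n)) (Q : Positions n) : Prop :=
  Function.Injective Q ∧
    ∃ K : Geometry.SimplicialComplex ℝ Plane,
      K.faces = {s : Finset Plane | ∃ σ ∈ Δ.faces, (s : Set Plane) = Q '' (σ : Set (Fin n))}

/-- The set `M_+` of admissible oriented meshes with connectivity `Δ`. -/
def admissibleMeshes {n NT : ℕ} {Δ : AbstractSimplicialComplex (Fin n)} (T : OrientedTriangles Δ NT) :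
    Set (Positions n) :=
  {Q | IsGeometricComplex Δ Q ∧ ∀ k, 0 < signedArea Q (T.vert k)}

/-- The manifold of planar triangular meshes: the `Q ∈ M_+` which can be joined to the reference
mesh by a continuous path inside `M_+`. -/
def planarManifold {n NT : ℕ} {Δ : AbstractSimplicialComplex (Fin n)} (T : OrientedTriangles Δ NT)
    (Qref : Positions n) : Set (Positions n) :=
  {Q | Q ∈ admissibleMeshes T ∧ JoinedIn (admissibleMeshes T) Q Qref}

/-! ### The regularized vertex-edge distance -/

/-- `N` is a `C³` estimate of the `1`-norm of `ℝ²` from below which is positive away from `0`. -/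
structure IsOneNormEstimate (N : ℝ × ℝ → ℝ) : Prop where
  contDiff : ContDiff ℝ 3 N
  nonneg : ∀ p, 0 ≤ N p
  le_oneNorm : ∀ p, N p ≤ |p.1| + |p.2|
  pos : ∀ p, p ≠ 0 → 0 < N p

/-- Coordinates of `x` in the positively oriented orthonormal frame whose first vector points from
`a` to `b`. -/
def edgeFrameCoords (a b x : Plane) : ℝ × ℝ :=
  (⟪b - a, x⟫ / ‖b - a‖, det₂ (b - a) x / ‖b - a‖)

/-- The regularized distance `min {N(Q i₀ - q) | q ∈ conv {Q j₀, Q j₁}}`, with `N` evaluated in the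
coordinate frame aligned with the edge `[j₀, j₁]`. -/
def regDist {n : ℕ} (N : ℝ × ℝ → ℝ) (Q : Positions n) (i₀ j₀ j₁ : Fin n) : ℝ :=
  sInf ((fun q => N (edgeFrameCoords (Q j₀) (Q j₁) (Q i₀ - q))) '' convexHull ℝ {Q j₀, Q j₁})

/-- The double sum over `[j₀, j₁] ∈ E_∂` and `i₀ ∈ V_∂`, `i₀ ≠ j₀, j₁`, of the reciprocal
regularized distances. -/
def boundarySum {n NT : ℕ} {Δ : AbstractSimplicialComplex (Fin n)} (T : OrientedTriangles Δ NT)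
    (N : ℝ × ℝ → ℝ) (c : ℝ) (Q : Positions n) : ℝ :=
  ∑ e ∈ boundaryEdges T, ∑ i₀ ∈ (boundaryVertices Δ).filter (fun i => i ≠ e.1 ∧ i ≠ e.2),
    c / regDist N Q i₀ e.1 e.2

/-- The squared Frobenius norm of `X ∈ ℝ^{2 × n}`. -/
def frobeniusSq {n : ℕ} (X : Positions n) : ℝ := ∑ i, ∑ r, (X i r) ^ 2

/-! ### The augmentation function and the penalty function -/

/-- The augmentation function `f_μ(Q; Qref)`. -/
def augmentation {n NT : ℕ} {Δ : AbstractSimplicialComplex (Fin n)} (T : OrientedTriangles Δ NT)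
    (N : ℝ × ℝ → ℝ) (β₁ β₂ β₃ : ℝ) (Qref Q : Positions n) : ℝ :=
  (∑ k, ∑ ℓ, β₁ / height Q (T.vert k) ℓ) + boundarySum T N β₂ Q + β₃ / 2 * frobeniusSq (Q - Qref)

/-- The reciprocal `1 / ψ_Q` of the triangle quality. -/
def invQuality {n : ℕ} (Q : Positions n) (t : Fin 3 → Fin n) : ℝ :=
  (edgeLength Q t 0 ^ 2 + edgeLength Q t 1 ^ 2 + edgeLength Q t 2 ^ 2) /
    (4 * √3 * signedArea Q t)

/-- The penalty function `φ(Q; Qref)`. -/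
def penalty {n NT : ℕ} {Δ : AbstractSimplicialComplex (Fin n)} (T : OrientedTriangles Δ NT)
    (N : ℝ × ℝ → ℝ) (α₁ α₂ α₃ α₄ : ℝ) (Qref Q : Positions n) : ℝ :=
  (∑ k, 1 / (NT : ℝ) * (α₁ * invQuality Q (T.vert k)))
    + α₂ / (∑ k, signedArea Q (T.vert k))
    + 1 / (((boundaryEdges T).card : ℝ) * ((boundaryVertices Δ).card : ℝ)) * boundarySum T N α₃ Q
    + α₄ / 2 * frobeniusSq (Q - Qref)

end PlanarMesh

end

namespace PlanarMesh

/-! Everything follows from compactness of the sublevel sets of the penalty in `planarManifold`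
(`isCompact_sublevel`). The augmentation function is continuous and nonnegative on
`admissibleMeshes`, so it is bounded on such a set; and the preimage of a compact set under the
continuous penalty is a closed subset of a sublevel set.

The Frobenius term makes a sublevel set bounded, so closedness is the point. The quality term gives
(edge length)² ≤ C · area, hence areas of triangles sharing an edge are comparable. Chains of
adjacent triangles make all areas comparable, and the total-area term then bounds each of them below
(`signedArea_ge_of_penalty_le`). The boundary sum bounds the regularized distances below
(`regDist_ge_of_penalty_le`). Both bounds survive in the limit.

It remains to see that a limit mesh is embedded. Being a geometric complex is equivalent to disjoint
faces having disjoint realizations, which is an open condition (`isGeometricComplex_iff`). Overlap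
of two open triangles is stable under perturbation, so in the limit the triangles still have
disjoint interiors. If a non-boundary face carries x in its relative interior, its star covers a
neighbourhood of x, so every triangle through x belongs to the star and no disjoint face meets x.
For an interior vertex this uses connectedness of small circles. Boundary faces are separated by the
distance bound; two boundary edges cannot cross, because an end of one would enter the triangle
behind the other (`facesDisjoint_of_boundarySeparated`). Finally, a small ball of admissible meshes
around the limit joins it to `Qref`. -/

variable {n : ℕ}

/-! ### Convex weights on faces -/

/-- `w` is a system of barycentric weights supported on `σ`. -/
structure IsWeight (σ : Finset (Fin n)) (w : Fin n → ℝ) : Prop where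
  nonneg : ∀ i, 0 ≤ w i
  zero : ∀ i, i ∉ σ → w i = 0
  sum_eq : ∑ i, w i = 1

theorem IsWeight.sum_mem {σ : Finset (Fin n)} {w : Fin n → ℝ} (hw : IsWeight σ w) {s : Set Plane}
    (hs : Convex ℝ s) {p : Fin n → Plane} (hp : ∀ i ∈ σ, p i ∈ s) : ∑ i, w i • p i ∈ s := by
  have h1 : ∑ i, w i • p i = ∑ i ∈ σ, w i • p i := by
    refine (Finset.sum_subset (Finset.subset_univ σ) fun i _ hi => ?_).symm
    rw [hw.zero i hi, zero_smul]
  have h2 : ∑ i ∈ σ, w i = 1 := by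
    rw [← hw.sum_eq]
    exact Finset.sum_subset (Finset.subset_univ σ) fun i _ hi => hw.zero i hi
  rw [h1]
  exact hs.sum_mem (fun i _ => hw.nonneg i) h2 hp

theorem isWeight_single {σ : Finset (Fin n)} {i : Fin n} (hi : i ∈ σ) :
    IsWeight σ (Pi.single i (1 : ℝ)) := by
  classical
  refine ⟨fun j => ?_, fun j hj => ?_, by simp⟩
  · by_cases h : j = i
    · subst h; simp
    · simp [h]
  · rw [Pi.single_apply, if_neg]
    rintro rfl
    exact hj hi

theorem mem_convexHull_image_iff {σ : Finset (Fin n)} {Q : Positions n} {x : Plane} :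
    x ∈ convexHull ℝ (Q '' (σ : Set (Fin n))) ↔ ∃ w, IsWeight σ w ∧ ∑ i, w i • Q i = x := by
  constructor
  · intro hx
    have hconv : Convex ℝ {x : Plane | ∃ w, IsWeight σ w ∧ ∑ i, w i • Q i = x} := by
      rintro _ ⟨w, hw, rfl⟩ _ ⟨v, hv, rfl⟩ a b ha hb hab
      refine ⟨fun i => a * w i + b * v i, ⟨fun i => ?_, fun i hi => ?_, ?_⟩, ?_⟩
      · have := hw.nonneg i; have := hv.nonneg i; positivity
      · rw [hw.zero i hi, hv.zero i hi]; ring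
      · rw [Finset.sum_add_distrib, ← Finset.mul_sum, ← Finset.mul_sum, hw.sum_eq, hv.sum_eq]
        linarith
      · simp only [add_smul, mul_smul, Finset.sum_add_distrib, Finset.smul_sum]
    refine convexHull_min ?_ hconv hx
    rintro _ ⟨i, hi, rfl⟩
    exact ⟨Pi.single i 1, isWeight_single hi, by simp [Pi.single_apply, ite_smul]⟩
  · rintro ⟨w, hw, rfl⟩
    exact hw.sum_mem (convex_convexHull ℝ _)
      fun i hi => subset_convexHull ℝ _ (Set.mem_image_of_mem _ hi)

/-! ### Geometric complexes and disjointness of faces -/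

/-- Disjoint faces of `Δ` have disjoint realizations. -/
def FacesDisjoint (Δ : AbstractSimplicialComplex (Fin n)) (Q : Positions n) : Prop :=
  ∀ σ ∈ Δ.faces, ∀ τ ∈ Δ.faces, Disjoint σ τ →
    Disjoint (convexHull ℝ (Q '' (σ : Set (Fin n)))) (convexHull ℝ (Q '' (τ : Set (Fin n))))

theorem mem_faces_of_subset {Δ : AbstractSimplicialComplex (Fin n)} {σ τ : Finset (Fin n)}
    (hσ : σ ∈ Δ.faces) (h : τ ⊆ σ) (hτ : τ.Nonempty) : τ ∈ Δ.faces :=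
  (Δ.isRelLowerSet_faces hσ).2 h hτ

theorem nonempty_of_mem_faces {Δ : AbstractSimplicialComplex (Fin n)} {σ : Finset (Fin n)}
    (hσ : σ ∈ Δ.faces) : σ.Nonempty :=
  (Δ.isRelLowerSet_faces hσ).1

/-- An affine dependence with positive part on one face and negative part on another is trivial. -/
theorem FacesDisjoint.eq_zero_of_sum_eq_zero {Δ : AbstractSimplicialComplex (Fin n)}
    {Q : Positions n} (hQ : FacesDisjoint Δ Q) {σ τ : Finset (Fin n)} (hσ : σ ∈ Δ.faces)
    (hτ : τ ∈ Δ.faces) {d : Fin n → ℝ} (hdσ : ∀ i, 0 < d i → i ∈ σ) (hdτ : ∀ i, d i < 0 → i ∈ τ)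
    (hd : ∑ i, d i = 0) (hdQ : ∑ i, d i • Q i = 0) (i : Fin n) : d i = 0 := by
  classical
  by_contra hi
  -- The positive and negative parts of `d` have equal mass `c` and equal moments. Divided by `c`,
  -- they are weights of one common point on two disjoint faces.
  have hsplit (j : Fin n) : d j = max (d j) 0 - max (-d j) 0 := by
    rcases le_total (d j) 0 with h | h
    · rw [max_eq_right h, max_eq_left (by linarith)]; ring
    · rw [max_eq_left h, max_eq_right (by linarith)]; ring
  have hc : ∑ j, max (d j) 0 = ∑ j, max (-d j) 0 := by
    rw [← sub_eq_zero, ← Finset.sum_sub_distrib]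
    refine Eq.trans ?_ hd
    exact Finset.sum_congr rfl fun j _ => (hsplit j).symm
  have hcQ : ∑ j, max (d j) 0 • Q j = ∑ j, max (-d j) 0 • Q j := by
    rw [← sub_eq_zero, ← Finset.sum_sub_distrib, ← hdQ]
    refine Finset.sum_congr rfl fun j _ => ?_
    rw [← sub_smul, ← hsplit j]
  set c := ∑ j, max (d j) 0 with hcdef
  have hcpos : 0 < c := by
    rcases lt_or_gt_of_ne hi with h | h
    · rw [hc]
      exact Finset.sum_pos' (fun j _ => le_max_right _ _)
        ⟨i, Finset.mem_univ i, lt_max_of_lt_left (by linarith)⟩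
    · exact Finset.sum_pos' (fun j _ => le_max_right _ _) ⟨i, Finset.mem_univ i, lt_max_of_lt_left h⟩
  have hwt (f : Fin n → ℝ) (hf : ∑ j, max (f j) 0 = c) :
      IsWeight (Finset.univ.filter fun j => 0 < f j) (fun j => c⁻¹ * max (f j) 0) := by
    refine ⟨fun j => by positivity, fun j hj => ?_, ?_⟩
    · rw [max_eq_right (by simpa using hj), mul_zero]
    · rw [← Finset.mul_sum, hf, inv_mul_cancel₀ hcpos.ne']
  have hne (f : Fin n → ℝ) (hf : ∑ j, max (f j) 0 = c) :
      (Finset.univ.filter fun j => 0 < f j).Nonempty := by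
    by_contra h
    rw [Finset.not_nonempty_iff_eq_empty] at h
    have := (hwt f hf).sum_eq
    rw [Finset.sum_eq_zero fun j _ => (hwt f hf).zero j (by simp [h])] at this
    exact zero_ne_one this
  have hP := mem_faces_of_subset hσ
    (fun j hj => hdσ j (by simpa using hj)) (hne d rfl)
  have hM := mem_faces_of_subset hτ
    (fun j hj => hdτ j (by simpa using hj)) (hne (fun j => -d j) hc.symm)
  have hdis : Disjoint (Finset.univ.filter fun j => 0 < d j)
      (Finset.univ.filter fun j => 0 < -d j) := by
    rw [Finset.disjoint_left]
    intro j h1 h2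
    simp only [Finset.mem_filter, Finset.mem_univ, true_and] at h1 h2
    linarith
  refine Set.disjoint_left.1 (hQ _ hP _ hM hdis) (mem_convexHull_image_iff.2 ⟨_, hwt d rfl, rfl⟩)
    (mem_convexHull_image_iff.2 ⟨_, hwt (fun j => -d j) hc.symm, ?_⟩)
  simp only [mul_smul, ← Finset.smul_sum]
  rw [hcQ]

/-- The difference `w - v` is an affine dependence, positive only on `σ` and negative only on `τ`.
-/
theorem FacesDisjoint.weight_unique {Δ : AbstractSimplicialComplex (Fin n)} {Q : Positions n}
    (hQ : FacesDisjoint Δ Q) {σ τ : Finset (Fin n)} (hσ : σ ∈ Δ.faces) (hτ : τ ∈ Δ.faces)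
    {w v : Fin n → ℝ} (hw : IsWeight σ w) (hv : IsWeight τ v)
    (h : ∑ i, w i • Q i = ∑ i, v i • Q i) : w = v := by
  funext i
  refine sub_eq_zero.1 (hQ.eq_zero_of_sum_eq_zero hσ hτ (d := fun i => w i - v i) ?_ ?_ ?_ ?_ i)
  · intro i hi
    by_contra hn
    have := hw.zero i hn
    have := hv.nonneg i
    linarith
  · intro i hi
    by_contra hn
    have := hv.zero i hn
    have := hw.nonneg i
    linarith
  · rw [Finset.sum_sub_distrib, hw.sum_eq, hv.sum_eq, sub_self]
  · simp only [sub_smul, Finset.sum_sub_distrib]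
    rw [h, sub_self]

theorem FacesDisjoint.injective {Δ : AbstractSimplicialComplex (Fin n)} {Q : Positions n}
    (hQ : FacesDisjoint Δ Q) : Function.Injective Q := by
  intro i j hij
  by_contra hne
  have h := hQ {i} (Δ.singleton_mem i) {j} (Δ.singleton_mem j) (by simpa using hne)
  simp [hij] at h

theorem FacesDisjoint.affineIndependent {Δ : AbstractSimplicialComplex (Fin n)} {Q : Positions n}
    (hQ : FacesDisjoint Δ Q) {σ : Finset (Fin n)} (hσ : σ ∈ Δ.faces) :
    AffineIndependent ℝ (fun i : σ => Q i) := by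
  classical
  rw [affineIndependent_iff]
  intro s w hw hwQ e he
  -- The dependence on the subtype `σ` is extended by zero to all vertices; both of its signs live
  -- on `σ`.
  have key := hQ.eq_zero_of_sum_eq_zero hσ hσ
    (d := fun i => ∑ e ∈ s, if (e : Fin n) = i then w e else 0) ?_ ?_ ?_ ?_ e
  · simpa [Subtype.ext_iff.symm, he] using key
  · intro i hi
    by_contra hn
    rw [Finset.sum_eq_zero] at hi
    · exact lt_irrefl _ hi
    · intro e _
      rw [if_neg]
      rintro rfl
      exact hn e.2
  · intro i hi
    by_contra hn
    rw [Finset.sum_eq_zero] at hi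
    · exact lt_irrefl _ hi
    · intro e _
      rw [if_neg]
      rintro rfl
      exact hn e.2
  · rw [Finset.sum_comm]
    simpa using hw
  · simp only [Finset.sum_smul]
    rw [Finset.sum_comm]
    simpa [ite_smul] using hwQ

theorem FacesDisjoint.isGeometricComplex {Δ : AbstractSimplicialComplex (Fin n)} {Q : Positions n}
    (hQ : FacesDisjoint Δ Q) : IsGeometricComplex Δ Q := by
  classical
  refine ⟨hQ.injective, ⟨⟨⟨_, ?_⟩, ?_, ?_⟩, rfl⟩⟩
  · rintro s ⟨σ, hσ, hs⟩
    refine ⟨?_, ?_⟩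
    · rw [← Finset.coe_nonempty, hs]
      exact (Finset.coe_nonempty.2 (nonempty_of_mem_faces hσ)).image Q
    · intro t hts ht
      refine ⟨σ.filter fun i => Q i ∈ t, mem_faces_of_subset hσ (Finset.filter_subset _ _) ?_, ?_⟩
      · obtain ⟨x, hx⟩ := ht
        have : x ∈ (s : Set Plane) := hts hx
        rw [hs] at this
        obtain ⟨i, hi, rfl⟩ := this
        exact ⟨i, Finset.mem_filter.2 ⟨hi, hx⟩⟩
      · ext x
        simp only [Finset.mem_coe, Finset.coe_filter, Set.mem_image, Set.mem_ofPred_eq]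
        constructor
        · intro hx
          have : x ∈ (s : Set Plane) := hts hx
          rw [hs] at this
          obtain ⟨i, hi, rfl⟩ := this
          exact ⟨i, ⟨hi, hx⟩, rfl⟩
        · rintro ⟨i, ⟨_, hx⟩, rfl⟩
          exact hx
  · rintro s ⟨σ, hσ, hs⟩
    have h := (hQ.affineIndependent hσ).range
    have heq : Set.range (fun i : σ => Q i) = (s : Set Plane) := by
      rw [hs]
      ext x
      simp
    rw [heq] at h
    exact h
  · rintro s t ⟨σ, hσ, hs⟩ ⟨τ, hτ, ht⟩ x ⟨hxs, hxt⟩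
    rw [hs] at hxs
    rw [ht] at hxt
    obtain ⟨w, hw, rfl⟩ := mem_convexHull_image_iff.1 hxs
    obtain ⟨v, hv, hvw⟩ := mem_convexHull_image_iff.1 hxt
    -- The weights of a common point agree, so they are supported on both faces and hence on `σ ∩
    -- τ`.
    obtain rfl := hQ.weight_unique hτ hσ hv hw hvw
    rw [hs, ht, ← Set.image_inter hQ.injective, ← Finset.coe_inter]
    refine mem_convexHull_image_iff.2 ⟨v, ⟨hv.nonneg, fun i hi => ?_, hv.sum_eq⟩, rfl⟩
    by_contra hne
    refine hi (Finset.mem_inter.2 ⟨?_, ?_⟩)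
    · by_contra h
      exact hne (hw.zero i h)
    · by_contra h
      exact hne (hv.zero i h)

theorem IsGeometricComplex.facesDisjoint {Δ : AbstractSimplicialComplex (Fin n)} {Q : Positions n}
    (hQ : IsGeometricComplex Δ Q) : FacesDisjoint Δ Q := by
  classical
  obtain ⟨hinj, K, hK⟩ := hQ
  intro σ hσ τ hτ hdis
  rw [Set.disjoint_iff]
  have hσK : σ.image Q ∈ K.faces := by
    rw [hK]; exact ⟨σ, hσ, by simp⟩
  have hτK : τ.image Q ∈ K.faces := by
    rw [hK]; exact ⟨τ, hτ, by simp⟩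
  have h := K.inter_subset_convexHull hσK hτK
  rw [Finset.coe_image, Finset.coe_image, ← Set.image_inter hinj, ← Finset.coe_inter,
    Finset.disjoint_iff_inter_eq_empty.1 hdis] at h
  simpa using h

theorem isGeometricComplex_iff {Δ : AbstractSimplicialComplex (Fin n)} {Q : Positions n} :
    IsGeometricComplex Δ Q ↔ FacesDisjoint Δ Q :=
  ⟨IsGeometricComplex.facesDisjoint, FacesDisjoint.isGeometricComplex⟩

/-! ### Openness of the set of admissible meshes -/

theorem isCompact_setOf_isWeight (σ : Finset (Fin n)) : IsCompact {w : Fin n → ℝ | IsWeight σ w} := by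
  have h : {w : Fin n → ℝ | IsWeight σ w} = stdSimplex ℝ (Fin n) ∩ {w | ∀ i, i ∉ σ → w i = 0} := by
    ext w
    exact ⟨fun h => ⟨⟨h.nonneg, h.sum_eq⟩, h.zero⟩, fun h => ⟨h.1.1, h.2, h.1.2⟩⟩
  rw [h]
  refine (isCompact_stdSimplex ℝ (Fin n)).inter_right ?_
  simp only [Set.ofPred_forall]
  exact isClosed_iInter fun i => isClosed_iInter fun _ => isClosed_eq (continuous_apply i)
    continuous_const

/-- The complement is the projection of a closed set of triples (mesh, weights, weights) along
compact weight simplices, and such projections are closed maps. -/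
theorem isOpen_setOf_disjoint_convexHull (σ τ : Finset (Fin n)) :
    IsOpen {Q : Positions n | Disjoint (convexHull ℝ (Q '' (σ : Set (Fin n))))
      (convexHull ℝ (Q '' (τ : Set (Fin n))))} := by
  have := isCompact_iff_compactSpace.1 (isCompact_setOf_isWeight σ)
  have := isCompact_iff_compactSpace.1 (isCompact_setOf_isWeight τ)
  have hclosed : IsClosed {p : Positions n × ({w : Fin n → ℝ | IsWeight σ w} ×
      {w : Fin n → ℝ | IsWeight τ w}) |
      ∑ i, (p.2.1 : Fin n → ℝ) i • p.1 i = ∑ i, (p.2.2 : Fin n → ℝ) i • p.1 i} := by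
    refine isClosed_eq (continuous_finsetSum _ fun i _ => ?_) (continuous_finsetSum _ fun i _ => ?_)
    · exact ((continuous_apply i).comp (continuous_subtype_val.comp
        (continuous_fst.comp continuous_snd))).smul ((continuous_apply i).comp continuous_fst)
    · exact ((continuous_apply i).comp (continuous_subtype_val.comp
        (continuous_snd.comp continuous_snd))).smul ((continuous_apply i).comp continuous_fst)
  rw [← isClosed_compl_iff]
  convert isClosedMap_fst_of_compactSpace _ hclosed using 1
  ext Q
  simp only [Set.mem_compl_iff, Set.mem_ofPred_eq, Set.not_disjoint_iff, mem_convexHull_image_iff,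
    Set.mem_image, Prod.exists, exists_and_right, exists_eq_right, Subtype.exists, exists_prop]
  constructor
  · rintro ⟨x, ⟨w, hw, rfl⟩, v, hv, h⟩
    exact ⟨w, hw, v, hv, h.symm⟩
  · rintro ⟨w, hw, v, hv, h⟩
    exact ⟨_, ⟨w, hw, rfl⟩, v, hv, h.symm⟩

theorem isOpen_setOf_facesDisjoint (Δ : AbstractSimplicialComplex (Fin n)) :
    IsOpen {Q : Positions n | FacesDisjoint Δ Q} := by
  simp only [FacesDisjoint, Set.ofPred_forall]
  exact isOpen_iInter_of_finite fun σ => isOpen_iInter_of_finite fun _ =>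
    isOpen_iInter_of_finite fun τ => isOpen_iInter_of_finite fun _ =>
      isOpen_iInter_of_finite fun _ => isOpen_setOf_disjoint_convexHull σ τ

theorem det₂_eq (u v : Plane) : det₂ u v = u 0 * v 1 - v 0 * u 1 := by
  rw [det₂, Matrix.det_fin_two_of]

@[fun_prop]
theorem continuous_det₂ {X : Type*} [TopologicalSpace X] {f g : X → Plane} (hf : Continuous f)
    (hg : Continuous g) : Continuous fun x => det₂ (f x) (g x) := by
  simp only [det₂_eq]
  fun_prop

@[fun_prop]
theorem continuous_signedArea (t : Fin 3 → Fin n) :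
    Continuous fun Q : Positions n => signedArea Q t := by
  unfold signedArea
  fun_prop

theorem isOpen_admissibleMeshes {NT : ℕ} {Δ : AbstractSimplicialComplex (Fin n)}
    (T : OrientedTriangles Δ NT) : IsOpen (admissibleMeshes T) := by
  simp only [admissibleMeshes, isGeometricComplex_iff, Set.ofPred_and, Set.ofPred_forall]
  exact (isOpen_setOf_facesDisjoint Δ).inter
    (isOpen_iInter_of_finite fun k => isOpen_lt continuous_const (continuous_signedArea _))

/-! ### Barycentric coordinates -/

/-- The barycentric coordinates of `y` in the triangle with vertex numbers `t`. -/
noncomputable def bary (Q : Positions n) (t : Fin 3 → Fin n) (ℓ : Fin 3) (y : Plane) : ℝ :=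
  det₂ (Q (t (ℓ + 1)) - y) (Q (t (ℓ + 2)) - y) / (2 * signedArea Q t)

/-- The terms quadratic in `y` cancel in the determinant, so barycentric coordinates are affine in
`y`. -/
theorem exists_bary_eq (Q : Positions n) (t : Fin 3 → Fin n) (ℓ : Fin 3) :
    ∃ c₀ c₁ c₂ : ℝ, ∀ y, bary Q t ℓ y = c₀ + c₁ * y 0 + c₂ * y 1 := by
  set a := Q (t (ℓ + 1))
  set b := Q (t (ℓ + 2))
  set A := 2 * signedArea Q t with hA
  refine ⟨(a 0 * b 1 - b 0 * a 1) / A, (a 1 - b 1) / A, (b 0 - a 0) / A, fun y => ?_⟩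
  simp only [bary, det₂_eq, PiLp.sub_apply]
  rw [← hA]
  ring

theorem bary_sum_smul {ι : Type*} [Fintype ι] (Q : Positions n) (t : Fin 3 → Fin n) (ℓ : Fin 3)
    {w : ι → ℝ} (hw : ∑ i, w i = 1) (p : ι → Plane) :
    bary Q t ℓ (∑ i, w i • p i) = ∑ i, w i * bary Q t ℓ (p i) := by
  obtain ⟨c₀, c₁, c₂, h⟩ := exists_bary_eq Q t ℓ
  simp only [h, mul_add, Finset.sum_add_distrib, WithLp.ofLp_sum, Finset.sum_apply, Finset.mul_sum,
    smul_eq_mul, WithLp.ofLp_smul, Pi.smul_apply]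
  rw [← Finset.sum_mul, hw, one_mul]
  congr 1
  · congr 1
    exact Finset.sum_congr rfl fun i _ => by ring
  · exact Finset.sum_congr rfl fun i _ => by ring

theorem bary_add_smul (Q : Positions n) (t : Fin 3 → Fin n) (ℓ : Fin 3) (s : ℝ) (x y : Plane) :
    bary Q t ℓ ((1 - s) • x + s • y) = (1 - s) * bary Q t ℓ x + s * bary Q t ℓ y := by
  have := bary_sum_smul Q t ℓ (w := ![1 - s, s]) (by simp) ![x, y]
  simpa using this

@[fun_prop]
theorem continuous_bary (Q : Positions n) (t : Fin 3 → Fin n) (ℓ : Fin 3) :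
    Continuous (bary Q t ℓ) := by
  unfold bary
  fun_prop

theorem sum_bary {Q : Positions n} {t : Fin 3 → Fin n} (hA : signedArea Q t ≠ 0) (y : Plane) :
    ∑ ℓ, bary Q t ℓ y = 1 := by
  simp only [bary, ← Finset.sum_div]
  rw [div_eq_one_iff_eq (by positivity)]
  simp only [Fin.sum_univ_three, signedArea, det₂_eq, PiLp.sub_apply, Fin.isValue]
  simp only [Fin.reduceAdd]
  ring

theorem sum_bary_smul {Q : Positions n} {t : Fin 3 → Fin n} (hA : signedArea Q t ≠ 0) (y : Plane) :
    ∑ ℓ, bary Q t ℓ y • Q (t ℓ) = y := by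
  have h2 : 2 * signedArea Q t ≠ 0 := by positivity
  ext r
  simp only [bary, Fin.sum_univ_three, PiLp.add_apply, PiLp.smul_apply, smul_eq_mul]
  rw [div_mul_eq_mul_div, div_mul_eq_mul_div, div_mul_eq_mul_div, ← add_div, ← add_div,
    div_eq_iff h2]
  fin_cases r <;>
  · simp only [signedArea, det₂_eq, PiLp.sub_apply, Fin.isValue]
    simp only [Fin.reduceAdd, Fin.isValue, Fin.zero_eta, Fin.mk_one]
    ring

theorem bary_vertex {Q : Positions n} {t : Fin 3 → Fin n} (hA : signedArea Q t ≠ 0) (ℓ m : Fin 3) :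
    bary Q t ℓ (Q (t m)) = if ℓ = m then 1 else 0 := by
  have h2 : 2 * signedArea Q t ≠ 0 := by positivity
  rw [bary, div_eq_iff h2]
  fin_cases ℓ <;> fin_cases m <;>
  · simp only [signedArea, det₂_eq, PiLp.sub_apply, Fin.isValue]
    simp only [Fin.reduceAdd, Fin.isValue, Fin.zero_eta, Fin.mk_one, Fin.reduceFinMk,
      Fin.reduceEq, if_true, if_false, one_ne_zero, zero_ne_one]
    ring

open Filter Topology

variable {NT : ℕ} {Δ : AbstractSimplicialComplex (Fin n)}

/-! ### Combinatorics of the numbered triangles. -/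

namespace OrientedTriangles

/-- The vertex set of the `k`-th triangle. -/
def tri (T : OrientedTriangles Δ NT) (k : Fin NT) : Finset (Fin n) := Finset.univ.image (T.vert k)

theorem tri_mem (T : OrientedTriangles Δ NT) (k : Fin NT) : T.tri k ∈ twoFaces Δ :=
  T.bijOn.mapsTo (Set.mem_univ k)

theorem tri_mem_faces (T : OrientedTriangles Δ NT) (k : Fin NT) : T.tri k ∈ Δ.faces :=
  (T.tri_mem k).1

theorem card_tri (T : OrientedTriangles Δ NT) (k : Fin NT) : (T.tri k).card = 3 := (T.tri_mem k).2

theorem tri_injective (T : OrientedTriangles Δ NT) : Function.Injective T.tri :=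
  fun _ _ h => T.bijOn.injOn (Set.mem_univ _) (Set.mem_univ _) h

theorem vert_injective (T : OrientedTriangles Δ NT) (k : Fin NT) :
    Function.Injective (T.vert k) := by
  have h : Set.InjOn (T.vert k) (Finset.univ : Finset (Fin 3)) :=
    Finset.card_image_iff.1 ((T.card_tri k).trans (by simp))
  rwa [Finset.coe_univ, Set.injOn_univ] at h

theorem vert_mem_tri (T : OrientedTriangles Δ NT) (k : Fin NT) (ℓ : Fin 3) :
    T.vert k ℓ ∈ T.tri k := Finset.mem_image_of_mem _ (Finset.mem_univ ℓ)

theorem mem_tri (T : OrientedTriangles Δ NT) {k : Fin NT} {i : Fin n} :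
    i ∈ T.tri k ↔ ∃ ℓ, T.vert k ℓ = i := by
  simp [tri]

theorem exists_tri_eq (T : OrientedTriangles Δ NT) {σ : Finset (Fin n)} (hσ : σ ∈ twoFaces Δ) :
    ∃ k, T.tri k = σ := by
  obtain ⟨k, -, hk⟩ := T.bijOn.surjOn hσ
  exact ⟨k, hk⟩

theorem exists_subset_tri (T : OrientedTriangles Δ NT) (hΔ : IsConnectivityComplex Δ)
    {τ : Finset (Fin n)} (hτ : τ ∈ Δ.faces) : ∃ k, τ ⊆ T.tri k := by
  obtain ⟨σ, hσ, h⟩ := hΔ.pure τ hτ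
  obtain ⟨k, rfl⟩ := T.exists_tri_eq hσ
  exact ⟨k, h⟩

theorem eq_of_tri_subset (T : OrientedTriangles Δ NT) {k k' : Fin NT} (h : T.tri k ⊆ T.tri k') :
    k = k' :=
  T.tri_injective (Finset.eq_of_subset_of_card_le h (by rw [T.card_tri, T.card_tri]))

/-- An edge of a triangle consists of the two vertices following the opposite vertex. -/
theorem exists_eq_pair (T : OrientedTriangles Δ NT) {k : Fin NT} {σ : Finset (Fin n)}
    (hσ : σ ⊆ T.tri k) (hcard : σ.card = 2) :
    ∃ ℓ, σ = {T.vert k (ℓ + 1), T.vert k (ℓ + 2)} := by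
  classical
  have h1 : (T.tri k \ σ).card = 1 := by
    rw [Finset.card_sdiff_of_subset hσ, T.card_tri, hcard]
  obtain ⟨i, hi⟩ := Finset.card_eq_one.1 h1
  have hik : i ∈ T.tri k \ σ := by rw [hi]; simp
  rw [Finset.mem_sdiff] at hik
  obtain ⟨ℓ, rfl⟩ := T.mem_tri.1 hik.1
  refine ⟨ℓ, Finset.eq_of_subset_of_card_le (fun j hj => ?_) ?_⟩
  · obtain ⟨m, rfl⟩ := T.mem_tri.1 (hσ hj)
    have hm : m ≠ ℓ := by
      rintro rfl
      exact hik.2 hj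
    have : m = ℓ + 1 ∨ m = ℓ + 2 := by
      revert hm
      clear * -
      revert m ℓ
      decide
    rcases this with rfl | rfl <;> simp
  · rw [hcard]
    exact Finset.card_le_two

end OrientedTriangles

/-! ### Weights on triangles and disjointness of interiors. -/

variable {T : OrientedTriangles Δ NT} {Q : Positions n}

theorem bary_sum_weight {k : Fin NT} (hA : 0 < signedArea Q (T.vert k)) {w : Fin n → ℝ}
    (hw : IsWeight (T.tri k) w) (ℓ : Fin 3) :
    bary Q (T.vert k) ℓ (∑ i, w i • Q i) = w (T.vert k ℓ) := by
  rw [bary_sum_smul Q _ ℓ hw.sum_eq Q,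
    ← Finset.sum_subset (Finset.subset_univ (T.tri k)) fun i _ hi => by rw [hw.zero i hi, zero_mul],
    OrientedTriangles.tri, Finset.sum_image fun a _ b _ h => T.vert_injective k h]
  simp [bary_vertex hA.ne']

theorem exists_weight_of_bary_nonneg {k : Fin NT} (hA : 0 < signedArea Q (T.vert k)) {y : Plane}
    (hy : ∀ ℓ, 0 ≤ bary Q (T.vert k) ℓ y) : ∃ w, IsWeight (T.tri k) w ∧ ∑ i, w i • Q i = y := by
  rw [← mem_convexHull_image_iff, ← sum_bary_smul hA.ne' y]
  exact (convex_convexHull ℝ _).sum_mem (fun ℓ _ => hy ℓ) (sum_bary hA.ne' y) fun ℓ _ =>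
    subset_convexHull ℝ _ (Set.mem_image_of_mem _ (T.vert_mem_tri k ℓ))

theorem IsWeight.mono {σ τ : Finset (Fin n)} {w : Fin n → ℝ} (hw : IsWeight σ w) (h : σ ⊆ τ) :
    IsWeight τ w :=
  ⟨hw.nonneg, fun i hi => hw.zero i fun hi' => hi (h hi'), hw.sum_eq⟩

theorem IsWeight.support {σ : Finset (Fin n)} {w : Fin n → ℝ} (hw : IsWeight σ w) :
    IsWeight (Finset.univ.filter fun i => 0 < w i) w :=
  ⟨hw.nonneg, fun i hi => le_antisymm (by simpa using hi) (hw.nonneg i), hw.sum_eq⟩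

theorem IsWeight.support_subset {σ : Finset (Fin n)} {w : Fin n → ℝ} (hw : IsWeight σ w) :
    (Finset.univ.filter fun i => 0 < w i) ⊆ σ := by
  intro i hi
  by_contra h
  have := hw.zero i h
  simp [this] at hi

theorem IsWeight.nonempty {σ : Finset (Fin n)} {w : Fin n → ℝ} (hw : IsWeight σ w) :
    σ.Nonempty := by
  by_contra h
  rw [Finset.not_nonempty_iff_eq_empty] at h
  have := hw.sum_eq
  rw [Finset.sum_eq_zero fun j _ => hw.zero j (by simp [h])] at this
  exact zero_ne_one this

theorem weight_unique_of_subset_tri {k : Fin NT} (hA : 0 < signedArea Q (T.vert k))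
    {w v : Fin n → ℝ} (hw : IsWeight (T.tri k) w) (hv : IsWeight (T.tri k) v)
    (h : ∑ i, w i • Q i = ∑ i, v i • Q i) : w = v := by
  funext i
  by_cases hi : i ∈ T.tri k
  · obtain ⟨ℓ, rfl⟩ := T.mem_tri.1 hi
    rw [← bary_sum_weight hA hw, h, bary_sum_weight hA hv]
  · rw [hw.zero i hi, hv.zero i hi]

/-- Distinct triangles have disjoint interiors. -/
def InteriorsDisjoint (T : OrientedTriangles Δ NT) (Q : Positions n) : Prop :=
  ∀ k k' y, (∀ ℓ, 0 < bary Q (T.vert k) ℓ y) → (∀ ℓ, 0 < bary Q (T.vert k') ℓ y) → k = k'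

theorem interiorsDisjoint_of_admissible (hQ : Q ∈ admissibleMeshes T) : InteriorsDisjoint T Q := by
  intro k k' y hk hk'
  obtain ⟨w, hw, rfl⟩ := exists_weight_of_bary_nonneg (hQ.2 k) fun ℓ => (hk ℓ).le
  obtain ⟨v, hv, hvw⟩ := exists_weight_of_bary_nonneg (hQ.2 k') fun ℓ => (hk' ℓ).le
  have heq := hQ.1.facesDisjoint.weight_unique (T.tri_mem_faces _) (T.tri_mem_faces _) hw hv hvw.symm
  refine T.eq_of_tri_subset fun i hi => ?_
  obtain ⟨ℓ, rfl⟩ := T.mem_tri.1 hi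
  by_contra hn
  have h1 := hk ℓ
  rw [bary_sum_weight (hQ.2 k) hw, heq, hv.zero _ hn] at h1
  exact lt_irrefl _ h1

theorem eventually_bary_pos {t : Fin 3 → Fin n} (hA : 0 < signedArea Q t) {y : Plane} {ℓ : Fin 3}
    (h : 0 < bary Q t ℓ y) : ∀ᶠ Q' in 𝓝 Q, 0 < bary Q' t ℓ y := by
  have : ContinuousAt (fun Q' => bary Q' t ℓ y) Q := by
    unfold bary
    refine ContinuousAt.div ?_ ?_ (by positivity)
    · exact Continuous.continuousAt (by fun_prop)
    · exact Continuous.continuousAt (by fun_prop)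
  exact this.eventually (lt_mem_nhds h)

/-- A point interior to two triangles stays interior to both for all nearby meshes, among them an
admissible one. -/
theorem interiorsDisjoint_of_mem_closure (hQ : Q ∈ closure (admissibleMeshes T))
    (hA : ∀ k, 0 < signedArea Q (T.vert k)) : InteriorsDisjoint T Q := by
  intro k k' y hk hk'
  have h1 : ∀ᶠ Q' in 𝓝 Q, (∀ ℓ, 0 < bary Q' (T.vert k) ℓ y) ∧ ∀ ℓ, 0 < bary Q' (T.vert k') ℓ y :=
    (eventually_all.2 fun ℓ => eventually_bary_pos (hA k) (hk ℓ)).and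
      (eventually_all.2 fun ℓ => eventually_bary_pos (hA k') (hk' ℓ))
  obtain ⟨Q', hQ', h2, h3⟩ := (mem_closure_iff_frequently.1 hQ).and_eventually h1 |>.exists
  exact interiorsDisjoint_of_admissible hQ' k k' y h2 h3

/-! ### Neighbourhoods covered by stars -/

theorem tendsto_segment (x z : Plane) :
    Tendsto (fun s : ℝ => (1 - s) • x + s • z) (𝓝[>] 0) (𝓝 x) := by
  have : Continuous fun s : ℝ => (1 - s) • x + s • z := by fun_prop
  have h := (this.tendsto 0).mono_left (nhdsWithin_le_nhds (s := Set.Ioi 0))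
  simpa using h

theorem eventually_lt_one : ∀ᶠ s : ℝ in 𝓝[>] 0, 0 < s ∧ s < 1 :=
  Ioo_mem_nhdsGT (zero_lt_one' ℝ)

theorem exists_interior_of_eventually {k : Fin NT} (hA : 0 < signedArea Q (T.vert k)) {x : Plane}
    (hx : ∀ ℓ, 0 ≤ bary Q (T.vert k) ℓ x) {P : Plane → Prop} (hP : ∀ᶠ y in 𝓝 x, P y) :
    ∃ y, P y ∧ ∀ ℓ, 0 < bary Q (T.vert k) ℓ y := by
  -- The point `x` is moved slightly towards the centroid, where all coordinates equal 1/3.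
  have hz (ℓ : Fin 3) :
      0 < bary Q (T.vert k) ℓ (∑ m : Fin 3, (1 / 3 : ℝ) • Q (T.vert k m)) := by
    rw [bary_sum_smul Q (T.vert k) ℓ (w := fun _ : Fin 3 => (1 / 3 : ℝ)) (by simp)]
    simp [bary_vertex hA.ne']
  obtain ⟨s, hs, h0, h1⟩ := (((tendsto_segment x
    (∑ m : Fin 3, (1 / 3 : ℝ) • Q (T.vert k m))).eventually hP).and eventually_lt_one).exists
  refine ⟨_, hs, fun ℓ => ?_⟩
  rw [bary_add_smul]
  have := mul_nonneg (sub_nonneg.2 h1.le) (hx ℓ)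
  have := mul_pos h0 (hz ℓ)
  linarith

/-- The triangles containing the face `σ` cover a neighbourhood of `x`. -/
def StarCovers (T : OrientedTriangles Δ NT) (Q : Positions n) (σ : Finset (Fin n)) (x : Plane) :
    Prop :=
  ∀ᶠ y in 𝓝 x, ∃ k, σ ⊆ T.tri k ∧ ∀ ℓ, 0 ≤ bary Q (T.vert k) ℓ y

theorem eventually_interior {k : Fin NT} {y : Plane} (hy : ∀ ℓ, 0 < bary Q (T.vert k) ℓ y) :
    ∀ᶠ z in 𝓝 y, ∀ ℓ, 0 < bary Q (T.vert k) ℓ z :=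
  eventually_all.2 fun ℓ => (continuous_bary Q _ ℓ).continuousAt.eventually (lt_mem_nhds (hy ℓ))

/-- Triangle `k` has interior points arbitrarily close to `x`. One of them lies in a star triangle
`k'`, and nearby interior points of `k'` are still interior to `k`; hence `k = k'`. -/
theorem StarCovers.subset_tri (hA : ∀ k, 0 < signedArea Q (T.vert k)) (hI : InteriorsDisjoint T Q)
    {σ : Finset (Fin n)} {x : Plane} (hc : StarCovers T Q σ x) {k : Fin NT}
    (hx : ∀ ℓ, 0 ≤ bary Q (T.vert k) ℓ x) : σ ⊆ T.tri k := by
  obtain ⟨y, ⟨k', hk', hy'⟩, hy⟩ := exists_interior_of_eventually (hA k) hx hc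
  obtain ⟨z, hz, hz'⟩ := exists_interior_of_eventually (hA k') hy' (eventually_interior hy)
  rwa [hI k k' z hz hz']

theorem bary_nonneg_of_weight {k : Fin NT} (hA : 0 < signedArea Q (T.vert k)) {τ : Finset (Fin n)}
    (hτ : τ ⊆ T.tri k) {w : Fin n → ℝ} (hw : IsWeight τ w) (ℓ : Fin 3) :
    0 ≤ bary Q (T.vert k) ℓ (∑ i, w i • Q i) := by
  rw [bary_sum_weight hA (hw.mono hτ)]
  exact hw.nonneg _

/-- A face disjoint from `σ` does not meet points of `σ` whose neighbourhoods are covered by the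
star of `σ`. -/
theorem StarCovers.ne_of_disjoint (hΔ : IsConnectivityComplex Δ)
    (hA : ∀ k, 0 < signedArea Q (T.vert k)) (hI : InteriorsDisjoint T Q) {σ τ : Finset (Fin n)}
    {w v : Fin n → ℝ} (hw : IsWeight σ w) (hc : StarCovers T Q σ (∑ i, w i • Q i))
    (hτ : τ ∈ Δ.faces) (hv : IsWeight τ v) (hd : Disjoint σ τ) :
    ∑ i, w i • Q i ≠ ∑ i, v i • Q i := by
  intro heq
  obtain ⟨k, hk⟩ := T.exists_subset_tri hΔ hτ
  have hσk : σ ⊆ T.tri k :=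
    hc.subset_tri hA hI (heq ▸ bary_nonneg_of_weight (hA k) hk hv)
  have hwv := weight_unique_of_subset_tri (hA k) (hw.mono hσk) (hv.mono hk) heq
  have hzero : ∀ i, w i = 0 := by
    intro i
    by_cases hi : i ∈ σ
    · rw [hwv]
      exact hv.zero i (Finset.disjoint_left.1 hd hi)
    · exact hw.zero i hi
  have := hw.sum_eq
  simp [hzero] at this

theorem starCovers_of_interior {k : Fin NT} {x : Plane} (hx : ∀ ℓ, 0 < bary Q (T.vert k) ℓ x) :
    StarCovers T Q (T.tri k) x := by
  filter_upwards [eventually_interior hx] with y hy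
  exact ⟨k, subset_rfl, fun ℓ => (hy ℓ).le⟩

theorem forall_fin_three_iff {P : Fin 3 → Prop} (ℓ : Fin 3) :
    (∀ m, P m) ↔ P ℓ ∧ P (ℓ + 1) ∧ P (ℓ + 2) := by
  refine ⟨fun h => ⟨h _, h _, h _⟩, fun ⟨h0, h1, h2⟩ m => ?_⟩
  have : m = ℓ ∨ m = ℓ + 1 ∨ m = ℓ + 2 := by
    clear * -
    revert m ℓ
    decide
  rcases this with rfl | rfl | rfl <;> assumption

/-- The barycentric coordinates vanishing on a common edge of two triangles are proportional. -/
theorem exists_bary_eq_mul {k k' : Fin NT} (hA : 0 < signedArea Q (T.vert k))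
    (hA' : 0 < signedArea Q (T.vert k')) {ℓ ℓ' : Fin 3}
    (h : ({T.vert k (ℓ + 1), T.vert k (ℓ + 2)} : Finset (Fin n)) =
      {T.vert k' (ℓ' + 1), T.vert k' (ℓ' + 2)}) :
    ∃ c : ℝ, c ≠ 0 ∧ ∀ y, bary Q (T.vert k') ℓ' y = c * bary Q (T.vert k) ℓ y := by
  have hpair : (T.vert k (ℓ + 1) = T.vert k' (ℓ' + 1) ∧ T.vert k (ℓ + 2) = T.vert k' (ℓ' + 2)) ∨
      (T.vert k (ℓ + 1) = T.vert k' (ℓ' + 2) ∧ T.vert k (ℓ + 2) = T.vert k' (ℓ' + 1)) := by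
    have h' := congrArg (fun s : Finset (Fin n) => (s : Set (Fin n))) h
    simp only [Finset.coe_pair] at h'
    exact Set.pair_eq_pair_iff.1 h'
  have h1 := hA.ne'
  have h2 := hA'.ne'
  rcases hpair with ⟨e1, e2⟩ | ⟨e1, e2⟩
  · refine ⟨signedArea Q (T.vert k) / signedArea Q (T.vert k'), by positivity, fun y => ?_⟩
    rw [bary, bary, e1, e2]
    field_simp
  · refine ⟨-(signedArea Q (T.vert k) / signedArea Q (T.vert k')),
      neg_ne_zero.2 (by positivity), fun y => ?_⟩
    rw [bary, bary, e1, e2, det₂_eq, det₂_eq]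
    field_simp
    ring

/-- Near `x` only the coordinate vanishing on the edge can change sign. For `c < 0` the triangles
lie on opposite sides and together cover a neighbourhood; for `c > 0` they lie on the same side and
overlap. -/
theorem starCovers_of_two_triangles (hA : ∀ k, 0 < signedArea Q (T.vert k))
    (hI : InteriorsDisjoint T Q) {σ : Finset (Fin n)} (hcard : σ.card = 2) {w : Fin n → ℝ}
    (hw : IsWeight σ w) (hpos : ∀ i ∈ σ, 0 < w i) {k k' : Fin NT} (hk : σ ⊆ T.tri k)
    (hk' : σ ⊆ T.tri k') (hne : k ≠ k') : StarCovers T Q σ (∑ i, w i • Q i) := by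
  obtain ⟨ℓ, hℓ⟩ := T.exists_eq_pair hk hcard
  obtain ⟨ℓ', hℓ'⟩ := T.exists_eq_pair hk' hcard
  obtain ⟨c, hc, hcy⟩ := exists_bary_eq_mul (hA k) (hA k') (hℓ.symm.trans hℓ')
  have hnear (k : Fin NT) (ℓ : Fin 3) (hk : σ ⊆ T.tri k)
      (hℓ : σ = {T.vert k (ℓ + 1), T.vert k (ℓ + 2)}) :
      ∀ᶠ y in 𝓝 (∑ i, w i • Q i),
        0 < bary Q (T.vert k) (ℓ + 1) y ∧ 0 < bary Q (T.vert k) (ℓ + 2) y := by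
    refine ((continuous_bary Q _ _).continuousAt.eventually (lt_mem_nhds ?_)).and
      ((continuous_bary Q _ _).continuousAt.eventually (lt_mem_nhds ?_))
    · rw [bary_sum_weight (hA k) (hw.mono hk)]
      exact hpos _ (by simp [hℓ])
    · rw [bary_sum_weight (hA k) (hw.mono hk)]
      exact hpos _ (by simp [hℓ])
  have hn := hnear k ℓ hk hℓ
  have hn' := hnear k' ℓ' hk' hℓ'
  rcases lt_or_gt_of_ne hc with hc | hc
  · filter_upwards [hn, hn'] with y hy hy'
    rcases le_total 0 (bary Q (T.vert k) ℓ y) with h | h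
    · exact ⟨k, hk, (forall_fin_three_iff ℓ).2 ⟨h, hy.1.le, hy.2.le⟩⟩
    · refine ⟨k', hk', (forall_fin_three_iff ℓ').2 ⟨?_, hy'.1.le, hy'.2.le⟩⟩
      rw [hcy]
      exact mul_nonneg_of_nonpos_of_nonpos hc.le h
  · obtain ⟨y, hy', hy⟩ :=
      exists_interior_of_eventually (hA k) (bary_nonneg_of_weight (hA k) hk hw) hn'
    refine absurd (hI k k' y hy ((forall_fin_three_iff ℓ').2 ⟨?_, hy'⟩)) hne
    rw [hcy]
    exact mul_pos hc (hy ℓ)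

theorem exists_two_triangles (hΔ : IsConnectivityComplex Δ) (T : OrientedTriangles Δ NT)
    {σ : Finset (Fin n)} (hσ : σ ∈ Δ.faces) (hcard : σ.card = 2) (hb : ¬ IsBoundaryEdge Δ σ) :
    ∃ k k', σ ⊆ T.tri k ∧ σ ⊆ T.tri k' ∧ k ≠ k' := by
  obtain ⟨k, hk⟩ := T.exists_subset_tri hΔ hσ
  by_contra! h
  refine hb ⟨hσ, hcard, T.tri k, ⟨T.tri_mem k, hk⟩, ?_⟩
  rintro ρ ⟨hρ, hσρ⟩
  obtain ⟨k', rfl⟩ := T.exists_tri_eq hρ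
  rw [h k k' hk hσρ]

theorem starCovers_of_two_le_card (hΔ : IsConnectivityComplex Δ)
    (hA : ∀ k, 0 < signedArea Q (T.vert k)) (hI : InteriorsDisjoint T Q) {σ : Finset (Fin n)}
    (hσ : σ ∈ Δ.faces) (hcard : 2 ≤ σ.card) (hb : ¬ IsBoundaryEdge Δ σ) {w : Fin n → ℝ}
    (hw : IsWeight σ w) (hpos : ∀ i ∈ σ, 0 < w i) : StarCovers T Q σ (∑ i, w i • Q i) := by
  obtain ⟨k, hk⟩ := T.exists_subset_tri hΔ hσ
  have hle := Finset.card_le_card hk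
  rw [T.card_tri] at hle
  rcases hcard.lt_or_eq with h3 | h2
  · have hσk : σ = T.tri k := Finset.eq_of_subset_of_card_le hk (by rw [T.card_tri]; exact h3)
    rw [hσk]
    refine starCovers_of_interior fun ℓ => ?_
    rw [bary_sum_weight (hA k) (hw.mono hk)]
    exact hpos _ (hσk ▸ T.vert_mem_tri k ℓ)
  · obtain ⟨k, k', h, h', hne⟩ := exists_two_triangles hΔ T hσ h2.symm hb
    exact starCovers_of_two_triangles hA hI h2.symm hw hpos h h' hne

/-- Around an interior vertex, small circles lie in the star of the vertex. -/
theorem sphere_subset_star (hΔ : IsConnectivityComplex Δ)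
    (hA : ∀ k, 0 < signedArea Q (T.vert k)) (hI : InteriorsDisjoint T Q) {v : Fin n}
    (hv : ¬ IsBoundaryVertex Δ v) {r : ℝ} (hr : 0 < r)
    (hpos : ∀ y, dist y (Q v) = r → ∀ k ℓ, T.vert k ℓ = v → 0 < bary Q (T.vert k) ℓ y)
    {y : Plane} (hy : dist y (Q v) = r) :
    ∃ k, {v} ⊆ T.tri k ∧ ∀ ℓ, 0 ≤ bary Q (T.vert k) ℓ y := by
  set G : Set Plane := {y | ∃ k, {v} ⊆ T.tri k ∧ ∀ ℓ, 0 ≤ bary Q (T.vert k) ℓ y} with hG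
  have hGclosed : IsClosed G := by
    simp only [hG, Set.ofPred_exists, Set.ofPred_and, Set.ofPred_forall]
    exact isClosed_iUnion_of_finite fun k => isClosed_const.inter
      (isClosed_iInter fun ℓ => isClosed_le continuous_const (continuous_bary Q _ ℓ))
  -- A point of the circle in the star differs from `Q v` and has positive weight at `v`. Its
  -- supporting face is therefore an edge or triangle at `v`, not a boundary edge, and the star of
  -- that face covers a neighbourhood. So `G` is open and closed relative to the connected circle.
  have hGint : Metric.sphere (Q v) r ∩ G ⊆ interior G := by
    rintro y ⟨hyS, k, hk, hyk⟩
    obtain ⟨w, hw, rfl⟩ := exists_weight_of_bary_nonneg (hA k) hyk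
    obtain ⟨ℓ, hℓ⟩ := T.mem_tri.1 (Finset.singleton_subset_iff.1 hk)
    have hwv : 0 < w v := by
      have := hpos _ hyS k ℓ hℓ
      rwa [bary_sum_weight (hA k) hw, hℓ] at this
    set σ := Finset.univ.filter fun i => 0 < w i with hσ
    have hvσ : v ∈ σ := by simp [hσ, hwv]
    have hσf : σ ∈ Δ.faces := mem_faces_of_subset (T.tri_mem_faces k) hw.support_subset ⟨v, hvσ⟩
    have hcard : 2 ≤ σ.card := by
      by_contra! hlt
      have h1 : σ.card ≤ 1 := by lia
      have hσv : σ = {v} := by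
        rw [Finset.eq_singleton_iff_unique_mem]
        exact ⟨hvσ, fun j hj => Finset.card_le_one.1 h1 j hj v hvσ⟩
      have h2 := hw.support
      rw [← hσ, hσv] at h2
      have h3 : ∑ i, w i • Q i ∈ ({Q v} : Set Plane) :=
        h2.sum_mem (convex_singleton (Q v)) (by simp)
      rw [Set.mem_singleton_iff.1 h3, Metric.mem_sphere, dist_self] at hyS
      exact hr.ne hyS
    have hc := starCovers_of_two_le_card hΔ hA hI hσf hcard (fun hb => hv ⟨σ, hb, hvσ⟩) hw.support
      (fun i hi => by simpa [hσ] using hi)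
    rw [mem_interior_iff_mem_nhds]
    filter_upwards [hc] with z ⟨k', hk', hz⟩
    exact ⟨k', Finset.singleton_subset_iff.2 (hk' hvσ), hz⟩
  have hpre : IsPreconnected (Metric.sphere (Q v) r) :=
    isPreconnected_sphere (by
      rw [← Module.finrank_eq_rank, finrank_euclideanSpace_fin]
      exact_mod_cast Nat.one_lt_two) _ _
  have hne : (Metric.sphere (Q v) r ∩ interior G).Nonempty := by
    obtain ⟨k, hk⟩ := T.exists_subset_tri hΔ (Δ.singleton_mem v)
    obtain ⟨ℓ, hℓ⟩ := T.mem_tri.1 (Finset.singleton_subset_iff.1 hk)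
    have hneq : Q (T.vert k (ℓ + 1)) ≠ Q v := by
      intro h
      have h1 := bary_vertex (hA k).ne' (ℓ + 1) (ℓ + 1)
      rw [h, ← hℓ, bary_vertex (hA k).ne'] at h1
      simp at h1
    have hn : 0 < ‖Q (T.vert k (ℓ + 1)) - Q v‖ := norm_pos_iff.2 (sub_ne_zero.2 hneq)
    -- The circle meets the star at the point `z` at distance `r` on the ray along an edge from `v`.
    -- Since `s` may exceed 1, nonnegativity of the coordinate at `v` comes from `hpos`.
    set s := r / ‖Q (T.vert k (ℓ + 1)) - Q v‖ with hs
    have hs0 : 0 < s := by positivity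
    set z := (1 - s) • Q v + s • Q (T.vert k (ℓ + 1)) with hz
    have hzS : dist z (Q v) = r := by
      have : z - Q v = s • (Q (T.vert k (ℓ + 1)) - Q v) := by rw [hz]; module
      rw [dist_eq_norm, this, norm_smul, Real.norm_of_nonneg hs0.le, hs, div_mul_cancel₀ _ hn.ne']
    refine ⟨z, hzS, hGint ⟨hzS, k, hk, fun m => ?_⟩⟩
    by_cases hm : m = ℓ
    · rw [hm]
      exact (hpos z hzS k ℓ hℓ).le
    · rw [hz, bary_add_smul, ← hℓ, bary_vertex (hA k).ne', bary_vertex (hA k).ne', if_neg hm]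
      split_ifs
      · linarith
      · simp
  have hsub := hpre.subset_left_of_subset_union isOpen_interior hGclosed.isOpen_compl
    (Set.disjoint_left.2 fun z hz hz' => hz' (interior_subset hz))
    (fun z hz => by
      by_cases hzG : z ∈ G
      · exact Or.inl (hGint ⟨hz, hzG⟩)
      · exact Or.inr hzG) hne
  have hyG : y ∈ G := interior_subset (hsub hy)
  exact hyG

/-- In a ball where all coordinates belonging to `v` stay positive, every point is either `Q v` or
on a circle handled by `sphere_subset_star`. -/
theorem starCovers_vertex (hΔ : IsConnectivityComplex Δ)
    (hA : ∀ k, 0 < signedArea Q (T.vert k)) (hI : InteriorsDisjoint T Q) {v : Fin n}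
    (hv : ¬ IsBoundaryVertex Δ v) : StarCovers T Q {v} (Q v) := by
  have h1 : ∀ᶠ y in 𝓝 (Q v), ∀ k ℓ, T.vert k ℓ = v → 0 < bary Q (T.vert k) ℓ y := by
    refine eventually_all.2 fun k => eventually_all.2 fun ℓ => eventually_all.2 fun hℓ => ?_
    refine (continuous_bary Q _ _).continuousAt.eventually (lt_mem_nhds ?_)
    rw [← hℓ, bary_vertex (hA k).ne', if_pos rfl]
    exact one_pos
  obtain ⟨ε, hε, hball⟩ := Metric.eventually_nhds_iff.1 h1
  refine Metric.eventually_nhds_iff.2 ⟨ε, hε, fun y hy => ?_⟩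
  rcases (dist_nonneg (x := y) (y := Q v)).eq_or_lt with h0 | h0
  · obtain ⟨k, hk⟩ := T.exists_subset_tri hΔ (Δ.singleton_mem v)
    obtain ⟨m, hm⟩ := T.mem_tri.1 (Finset.singleton_subset_iff.1 hk)
    refine ⟨k, hk, fun ℓ => ?_⟩
    rw [dist_eq_zero.1 h0.symm, ← hm, bary_vertex (hA k).ne']
    split_ifs <;> norm_num
  · exact sphere_subset_star hΔ hA hI hv h0 (fun z hz => hball (hz.trans_lt hy)) rfl

/-! ### Boundary faces -/

/-- No boundary vertex lies on a boundary edge which does not contain it. -/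
def BoundarySeparated (Δ : AbstractSimplicialComplex (Fin n)) (Q : Positions n) : Prop :=
  ∀ e v, IsBoundaryEdge Δ e → IsBoundaryVertex Δ v → v ∉ e →
    Q v ∉ convexHull ℝ (Q '' (e : Set (Fin n)))

theorem sum_single_smul (v : Fin n) (Q : Positions n) :
    ∑ i, (Pi.single v (1 : ℝ) : Fin n → ℝ) i • Q i = Q v := by
  simp [Pi.single_apply, ite_smul]

theorem IsWeight.sum_singleton {v : Fin n} {w : Fin n → ℝ} (hw : IsWeight {v} w) (Q : Positions n) :
    ∑ i, w i • Q i = Q v :=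
  Set.mem_singleton_iff.1 (hw.sum_mem (convex_singleton (Q v)) (by simp))

theorem BoundarySeparated.ne_of_ne (hΔ : IsConnectivityComplex Δ)
    (hA : ∀ k, 0 < signedArea Q (T.vert k)) (hS : BoundarySeparated Δ Q) {u v : Fin n}
    (hu : IsBoundaryVertex Δ u) (hv : IsBoundaryVertex Δ v) (hne : u ≠ v) : Q u ≠ Q v := by
  obtain ⟨e, he, hue⟩ := hu
  intro heq
  by_cases hve : v ∈ e
  · obtain ⟨k, hk⟩ := T.exists_subset_tri hΔ he.1
    have h := weight_unique_of_subset_tri (hA k) (isWeight_single (hk hue))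
      (isWeight_single (hk hve)) (by rw [sum_single_smul, sum_single_smul, heq])
    have := congrFun h u
    simp [hne] at this
  · exact hS e v he hv hve (heq ▸ subset_convexHull ℝ _ (Set.mem_image_of_mem Q hue))

theorem IsWeight.sum_pair {M : Type*} [AddCommGroup M] [Module ℝ M] {a b : Fin n} (hab : a ≠ b)
    {w : Fin n → ℝ} (hw : IsWeight {a, b} w) (p : Fin n → M) :
    ∑ i, w i • p i = w a • p a + w b • p b := by
  rw [← Finset.sum_pair (f := fun i => w i • p i) hab]
  refine (Finset.sum_subset (Finset.subset_univ _) fun i _ hi => ?_).symm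
  rw [hw.zero i hi, zero_smul]

theorem IsWeight.add_eq_one {a b : Fin n} (hab : a ≠ b) {w : Fin n → ℝ} (hw : IsWeight {a, b} w) :
    w a + w b = 1 := by
  have := hw.sum_pair hab (fun _ => (1 : ℝ))
  simp only [smul_eq_mul, mul_one, hw.sum_eq] at this
  exact this.symm

/-- A segment through a relative interior point of a disjoint edge does not enter a triangle at that
edge. -/
theorem bary_nonpos_of_mem_hull (hΔ : IsConnectivityComplex Δ)
    (hA : ∀ k, 0 < signedArea Q (T.vert k)) (hI : InteriorsDisjoint T Q) {σ τ : Finset (Fin n)}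
    (hτ : τ ∈ Δ.faces) (hσ2 : σ.card = 2) (hτ2 : τ.card = 2) (hd : Disjoint σ τ)
    {k : Fin NT} (hk : σ ⊆ T.tri k) {ℓ : Fin 3} (hℓ : σ = {T.vert k (ℓ + 1), T.vert k (ℓ + 2)})
    {w v : Fin n → ℝ} (hw : IsWeight σ w) (hpos : ∀ i ∈ σ, 0 < w i) (hv : IsWeight τ v)
    (heq : ∑ i, w i • Q i = ∑ i, v i • Q i) {j : Fin n} (hj : j ∈ τ) :
    bary Q (T.vert k) ℓ (Q j) ≤ 0 := by
  by_contra! hjpos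
  have hx0 (m : Fin 3) : bary Q (T.vert k) m (∑ i, w i • Q i) = w (T.vert k m) :=
    bary_sum_weight (hA k) (hw.mono hk) m
  have h12 : ∀ m, m = ℓ + 1 ∨ m = ℓ + 2 → ∀ᶠ y in 𝓝 (∑ i, w i • Q i),
      0 < bary Q (T.vert k) m y := by
    intro m hm
    refine (continuous_bary Q _ m).continuousAt.eventually (lt_mem_nhds ?_)
    rw [hx0]
    apply hpos
    rw [hℓ]
    rcases hm with rfl | rfl <;> simp
  obtain ⟨s, ⟨h1, h2⟩, hs0, hs1⟩ := (((tendsto_segment (∑ i, w i • Q i) (Q j)).eventually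
    ((h12 _ (Or.inl rfl)).and (h12 _ (Or.inr rfl)))).and eventually_lt_one).exists
  have hy : ∀ m, 0 < bary Q (T.vert k) m ((1 - s) • ∑ i, w i • Q i + s • Q j) := by
    refine (forall_fin_three_iff ℓ).2 ⟨?_, h1, h2⟩
    rw [bary_add_smul, hx0]
    have := mul_nonneg (sub_nonneg.2 hs1.le) (hw.nonneg (T.vert k ℓ))
    have := mul_pos hs0 hjpos
    linarith
  obtain ⟨k', hk'⟩ := T.exists_subset_tri hΔ hτ
  have hk'y : ∀ m, 0 ≤ bary Q (T.vert k') m ((1 - s) • ∑ i, w i • Q i + s • Q j) := by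
    intro m
    rw [bary_add_smul, heq]
    have h3 := mul_nonneg (sub_nonneg.2 hs1.le) (bary_nonneg_of_weight (hA k') hk' hv m)
    have h4 := bary_nonneg_of_weight (hA k') hk' (isWeight_single hj) m
    rw [sum_single_smul] at h4
    have h5 := mul_nonneg hs0.le h4
    linarith
  -- A triangle containing `τ` reaches interior points of triangle `k`, so it contains `σ` as well.
  -- That would be four vertices.
  have hkk' := (starCovers_of_interior hy).subset_tri hA hI hk'y
  have hle := Finset.card_le_card (Finset.union_subset (hk.trans hkk') hk')
  rw [Finset.card_union_of_disjoint hd, hσ2, hτ2, T.card_tri] at hle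
  lia

/-- A convex combination in (0, 1) of two numbers outside [0, 1] forces them onto opposite sides, so
the segment between them passes through 0. -/
theorem segment_hits_endpoint {s t x θ : ℝ} (hs : s < 0 ∨ 1 < s) (ht : t < 0 ∨ 1 < t)
    (hθ : 0 < θ) (hθ1 : θ < 1) (hx0 : 0 < x) (hx1 : x < 1) (h : θ * s + (1 - θ) * t = x) :
    ∃ c, 0 ≤ c ∧ c ≤ 1 ∧ (1 - c) * s + c * t = 0 := by
  have hcase : s < 0 ∧ 1 < t ∨ 1 < s ∧ t < 0 := by
    rcases hs with hs | hs <;> rcases ht with ht | ht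
    · nlinarith
    · exact Or.inl ⟨hs, ht⟩
    · exact Or.inr ⟨hs, ht⟩
    · nlinarith
  rcases hcase with ⟨hs, ht⟩ | ⟨hs, ht⟩
  · have hst : 0 < t - s := by linarith
    refine ⟨-s / (t - s), div_nonneg (by linarith) hst.le, (div_le_one hst).2 (by linarith), ?_⟩
    field_simp
    ring
  · have hst : 0 < s - t := by linarith
    refine ⟨s / (s - t), div_nonneg (by linarith) hst.le, (div_le_one hst).2 (by linarith), ?_⟩
    field_simp
    ring

/-- Neither end of `τ` lies strictly on the triangle's side of `σ`, yet a point inside `τ` lies on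
the line of `σ`; so the edges are collinear. No end of `τ` lies on `σ`, hence `τ` passes over an end
of `σ`, against separation. -/
theorem BoundarySeparated.edges_disjoint (hΔ : IsConnectivityComplex Δ)
    (hA : ∀ k, 0 < signedArea Q (T.vert k)) (hI : InteriorsDisjoint T Q)
    (hS : BoundarySeparated Δ Q) {σ τ : Finset (Fin n)} (hσ : IsBoundaryEdge Δ σ)
    (hτ : IsBoundaryEdge Δ τ) (hd : Disjoint σ τ) {w v : Fin n → ℝ} (hw : IsWeight σ w)
    (hpos : ∀ i ∈ σ, 0 < w i) (hv : IsWeight τ v) (hvpos : ∀ i ∈ τ, 0 < v i) :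
    ∑ i, w i • Q i ≠ ∑ i, v i • Q i := by
  intro heq
  obtain ⟨k, hk⟩ := T.exists_subset_tri hΔ hσ.1
  obtain ⟨ℓ, hℓ⟩ := T.exists_eq_pair hk hσ.2.1
  obtain ⟨d, e, hde, rfl⟩ := Finset.card_eq_two.1 hτ.2.1
  have hd0 := bary_nonpos_of_mem_hull hΔ hA hI hτ.1 hσ.2.1 hτ.2.1 hd hk hℓ hw hpos hv heq
    (j := d) (by simp)
  have he0 := bary_nonpos_of_mem_hull hΔ hA hI hτ.1 hσ.2.1 hτ.2.1 hd hk hℓ hw hpos hv heq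
    (j := e) (by simp)
  have hdpos := hvpos d (by simp)
  have hepos := hvpos e (by simp)
  have hsum := hv.add_eq_one hde
  have hx (m : Fin 3) : v d * bary Q (T.vert k) m (Q d) + v e * bary Q (T.vert k) m (Q e) =
      w (T.vert k m) := by
    rw [← bary_sum_weight (hA k) (hw.mono hk) m, heq, bary_sum_smul _ _ _ hv.sum_eq]
    exact (hv.sum_pair hde fun i => bary Q (T.vert k) m (Q i)).symm
  have hℓσ : T.vert k ℓ ∉ σ := by
    rw [hℓ]
    have h1 : ℓ ≠ ℓ + 1 := by simp
    have h2 : ℓ ≠ ℓ + 2 := by simp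
    simp [(T.vert_injective k).eq_iff, h1, h2]
  have hxℓ := hx ℓ
  rw [hw.zero _ hℓσ] at hxℓ
  -- Two nonpositive numbers with a vanishing positive combination are both zero.
  have hdz : bary Q (T.vert k) ℓ (Q d) = 0 := by nlinarith
  have hez : bary Q (T.vert k) ℓ (Q e) = 0 := by nlinarith
  have h12 : T.vert k (ℓ + 1) ≠ T.vert k (ℓ + 2) := by
    intro h
    have := T.vert_injective k h
    simp at this
  have hsum3 (f : Fin 3 → ℝ) : ∑ m, f m = f ℓ + f (ℓ + 1) + f (ℓ + 2) := by
    rw [Fin.sum_univ_three]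
    clear * -
    fin_cases ℓ
    · rfl
    · change f 0 + f 1 + f 2 = f 1 + f 2 + f 0; ring
    · change f 0 + f 1 + f 2 = f 2 + f 0 + f 1; ring
  have hbd {j : Fin n} (hj : IsBoundaryVertex Δ j) (hjσ : j ∉ σ)
      (hjz : bary Q (T.vert k) ℓ (Q j) = 0) :
      bary Q (T.vert k) (ℓ + 2) (Q j) < 0 ∨ 1 < bary Q (T.vert k) (ℓ + 2) (Q j) := by
    by_contra! hcon
    refine hS σ j hσ hj hjσ ?_
    have h1 := sum_bary (hA k).ne' (Q j)
    rw [hsum3, hjz, zero_add] at h1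
    obtain ⟨u, hu, huj⟩ := exists_weight_of_bary_nonneg (hA k) (y := Q j)
      ((forall_fin_three_iff ℓ).2 ⟨hjz.ge, by linarith, hcon.1⟩)
    refine mem_convexHull_image_iff.2 ⟨u, ⟨hu.nonneg, fun i hi => ?_, hu.sum_eq⟩, huj⟩
    by_cases hik : i ∈ T.tri k
    · obtain ⟨m, rfl⟩ := T.mem_tri.1 hik
      have hm : m = ℓ := by
        by_contra hm
        refine hi ?_
        have : m = ℓ + 1 ∨ m = ℓ + 2 := by
          revert hm
          clear * -
          revert m ℓ
          decide
        rw [hℓ]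
        rcases this with rfl | rfl <;> simp
      rw [hm, ← bary_sum_weight (hA k) hu, huj, hjz]
    · exact hu.zero i hik
  have hdσ : d ∉ σ := fun h => Finset.disjoint_left.1 hd h (by simp)
  have heσ : e ∉ σ := fun h => Finset.disjoint_left.1 hd h (by simp)
  have hw12 : w (T.vert k (ℓ + 1)) + w (T.vert k (ℓ + 2)) = 1 := (hℓ ▸ hw).add_eq_one h12
  have hw1 := hpos (T.vert k (ℓ + 1)) (by rw [hℓ]; simp)
  have hw2 := hpos (T.vert k (ℓ + 2)) (by rw [hℓ]; simp)
  obtain ⟨c, hc0, hc1, hc⟩ := segment_hits_endpoint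
    (hbd ⟨_, hτ, by simp⟩ hdσ hdz) (hbd ⟨_, hτ, by simp⟩ heσ hez) hdpos (by linarith) hw2
    (by linarith) (by rw [← hx (ℓ + 2), ← hsum]; ring)
  have ha : T.vert k (ℓ + 1) ∈ σ := by rw [hℓ]; simp
  refine hS {d, e} (T.vert k (ℓ + 1)) hτ ⟨σ, hσ, ha⟩ (Finset.disjoint_left.1 hd ha) ?_
  have hpt : Q (T.vert k (ℓ + 1)) = (1 - c) • Q d + c • Q e := by
    have hb (m : Fin 3) : bary Q (T.vert k) m ((1 - c) • Q d + c • Q e) =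
        if m = ℓ + 1 then 1 else 0 := by
      have hb0 : bary Q (T.vert k) ℓ ((1 - c) • Q d + c • Q e) = 0 := by
        rw [bary_add_smul, hdz, hez]; ring
      have hb2 : bary Q (T.vert k) (ℓ + 2) ((1 - c) • Q d + c • Q e) = 0 := by
        rw [bary_add_smul, hc]
      have hb1 := sum_bary (hA k).ne' ((1 - c) • Q d + c • Q e)
      rw [hsum3, hb0, hb2] at hb1
      revert m
      refine (forall_fin_three_iff ℓ).2 ⟨?_, ?_, ?_⟩
      · rw [hb0, if_neg (by simp)]
      · rw [if_pos rfl]; linarith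
      · rw [hb2, if_neg (by simp)]
    conv_rhs => rw [← sum_bary_smul (hA k).ne' ((1 - c) • Q d + c • Q e)]
    simp [hb]
  rw [hpt]
  refine convex_convexHull ℝ _ (subset_convexHull ℝ _ ?_) (subset_convexHull ℝ _ ?_)
    (by linarith) hc0 (by ring)
  · exact Set.mem_image_of_mem Q (by simp)
  · exact Set.mem_image_of_mem Q (by simp)

theorem BoundarySeparated.vertex_ne (hS : BoundarySeparated Δ Q) {u : Fin n} {τ : Finset (Fin n)}
    (hu : IsBoundaryVertex Δ u) (hτ : IsBoundaryEdge Δ τ) (huτ : u ∉ τ) {v : Fin n → ℝ}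
    (hv : IsWeight τ v) : Q u ≠ ∑ i, v i • Q i :=
  fun h => hS τ u hτ hu huτ (mem_convexHull_image_iff.2 ⟨v, hv, h.symm⟩)

theorem starCovers_or_boundary (hΔ : IsConnectivityComplex Δ)
    (hA : ∀ k, 0 < signedArea Q (T.vert k)) (hI : InteriorsDisjoint T Q) {σ : Finset (Fin n)}
    (hσ : σ ∈ Δ.faces) {w : Fin n → ℝ} (hw : IsWeight σ w) (hpos : ∀ i ∈ σ, 0 < w i) :
    StarCovers T Q σ (∑ i, w i • Q i) ∨ IsBoundaryEdge Δ σ ∨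
      ∃ v, σ = {v} ∧ IsBoundaryVertex Δ v := by
  rcases le_or_gt 2 σ.card with h2 | h2
  · by_cases hb : IsBoundaryEdge Δ σ
    · exact Or.inr (Or.inl hb)
    · exact Or.inl (starCovers_of_two_le_card hΔ hA hI hσ h2 hb hw hpos)
  · have := Finset.card_pos.2 hw.nonempty
    obtain ⟨v, rfl⟩ := Finset.card_eq_one.1 (by lia : σ.card = 1)
    by_cases hb : IsBoundaryVertex Δ v
    · exact Or.inr (Or.inr ⟨v, rfl, hb⟩)
    · left
      rw [hw.sum_singleton]
      exact starCovers_vertex hΔ hA hI hb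

/-- Positively oriented triangles with disjoint interiors whose boundary does not touch itself form
a geometric complex. -/
theorem facesDisjoint_of_boundarySeparated (hΔ : IsConnectivityComplex Δ)
    (hA : ∀ k, 0 < signedArea Q (T.vert k)) (hI : InteriorsDisjoint T Q)
    (hS : BoundarySeparated Δ Q) : FacesDisjoint Δ Q := by
  intro σ' hσ' τ' hτ' hd'
  rw [Set.disjoint_left]
  intro x hx hx'
  obtain ⟨w, hw', rfl⟩ := mem_convexHull_image_iff.1 hx
  obtain ⟨v, hv', hvw⟩ := mem_convexHull_image_iff.1 hx'
  -- Both faces are shrunk to the supports of the weights, which puts the common point in their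
  -- relative interiors.
  have hw := hw'.support
  have hv := hv'.support
  have hd := Finset.disjoint_of_subset_left hw'.support_subset
    (Finset.disjoint_of_subset_right hv'.support_subset hd')
  have hσ := mem_faces_of_subset hσ' hw'.support_subset hw.nonempty
  have hτ := mem_faces_of_subset hτ' hv'.support_subset hv.nonempty
  have hwpos : ∀ i ∈ Finset.univ.filter fun i => 0 < w i, 0 < w i := fun i hi => by simpa using hi
  have hvpos : ∀ i ∈ Finset.univ.filter fun i => 0 < v i, 0 < v i := fun i hi => by simpa using hi
  generalize (Finset.univ.filter fun i => 0 < w i) = σ at *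
  generalize (Finset.univ.filter fun i => 0 < v i) = τ at *
  rcases starCovers_or_boundary hΔ hA hI hσ hw hwpos with hc | hσb | ⟨a, rfl, ha⟩
  · exact hc.ne_of_disjoint hΔ hA hI hw hτ hv hd hvw.symm
  · rcases starCovers_or_boundary hΔ hA hI hτ hv hvpos with hc | hτb | ⟨b, rfl, hb⟩
    · exact hc.ne_of_disjoint hΔ hA hI hv hσ hw hd.symm hvw
    · exact hS.edges_disjoint hΔ hA hI hσb hτb hd hw hwpos hv hvpos hvw.symm
    · rw [hv.sum_singleton] at hvw
      exact hS.vertex_ne hb hσb (by simpa using hd) hw hvw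
  · rcases starCovers_or_boundary hΔ hA hI hτ hv hvpos with hc | hτb | ⟨b, rfl, hb⟩
    · exact hc.ne_of_disjoint hΔ hA hI hv hσ hw hd.symm hvw
    · rw [hw.sum_singleton] at hvw
      exact hS.vertex_ne ha hτb (by simpa using hd) hv hvw.symm
    · rw [hv.sum_singleton, hw.sum_singleton] at hvw
      exact hS.ne_of_ne hΔ hA hb ha (by simpa [eq_comm] using hd) hvw

variable {N : ℝ × ℝ → ℝ}

/-! ### The regularized distance -/

theorem norm_sq_eq (x : Plane) : ‖x‖ ^ 2 = x 0 ^ 2 + x 1 ^ 2 := by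
  rw [EuclideanSpace.real_norm_sq_eq, Fin.sum_univ_two]

theorem inner_eq (x y : Plane) : ⟪x, y⟫ = x 0 * y 0 + x 1 * y 1 := by
  simp [PiLp.inner_apply, Fin.sum_univ_two, mul_comm]

/-- Lagrange's identity: it makes the edge frame faithful and bounds areas by products of edge
lengths. -/
theorem inner_sq_add_det₂_sq (u x : Plane) : ⟪u, x⟫ ^ 2 + det₂ u x ^ 2 = ‖u‖ ^ 2 * ‖x‖ ^ 2 := by
  rw [inner_eq, det₂_eq, norm_sq_eq, norm_sq_eq]
  ring

theorem edgeFrameCoords_zero (a b : Plane) : edgeFrameCoords a b 0 = 0 := by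
  simp [edgeFrameCoords, det₂_eq]

theorem eq_zero_of_edgeFrameCoords_eq_zero {a b x : Plane} (hab : a ≠ b)
    (h : edgeFrameCoords a b x = 0) : x = 0 := by
  have hn : ‖b - a‖ ≠ 0 := norm_ne_zero_iff.2 (sub_ne_zero.2 hab.symm)
  simp only [edgeFrameCoords, Prod.mk_eq_zero, div_eq_zero_iff, hn, or_false] at h
  have h1 := inner_sq_add_det₂_sq (b - a) x
  rw [h.1, h.2] at h1
  have h2 : ‖x‖ ^ 2 = 0 := by
    rcases mul_eq_zero.1 (h1.symm.trans (by norm_num)) with h3 | h3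
    · exact absurd h3 (pow_ne_zero 2 hn)
    · exact h3
  simpa using h2

theorem IsOneNormEstimate.apply_zero (hN : IsOneNormEstimate N) : N 0 = 0 :=
  le_antisymm (by simpa using hN.le_oneNorm 0) (hN.nonneg 0)

theorem regDist_eq (Q : Positions n) (i₀ j₀ j₁ : Fin n) :
    regDist N Q i₀ j₀ j₁ = sInf ((fun θ : ℝ => N (edgeFrameCoords (Q j₀) (Q j₁)
      (Q i₀ - ((1 - θ) • Q j₀ + θ • Q j₁)))) '' Set.Icc 0 1) := by
  rw [regDist, convexHull_pair, segment_eq_image, Set.image_image]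

theorem regDist_nonneg (hN : IsOneNormEstimate N) (Q : Positions n) (i₀ j₀ j₁ : Fin n) :
    0 ≤ regDist N Q i₀ j₀ j₁ := by
  refine Real.sInf_nonneg ?_
  rintro _ ⟨q, -, rfl⟩
  exact hN.nonneg _

theorem regDist_eq_zero (hN : IsOneNormEstimate N) {i₀ j₀ j₁ : Fin n}
    (h : Q i₀ ∈ convexHull ℝ {Q j₀, Q j₁}) : regDist N Q i₀ j₀ j₁ = 0 := by
  refine le_antisymm ?_ (regDist_nonneg hN Q i₀ j₀ j₁)
  refine csInf_le ⟨0, ?_⟩ ⟨Q i₀, h, ?_⟩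
  · rintro _ ⟨q, -, rfl⟩
    exact hN.nonneg _
  · simp only [sub_self, edgeFrameCoords_zero, hN.apply_zero]

theorem continuous_frame_family (hN : IsOneNormEstimate N) (i₀ j₀ j₁ : Fin n) :
    Continuous fun p : {Q : Positions n // Q j₀ ≠ Q j₁} × ℝ =>
      N (edgeFrameCoords (p.1.1 j₀) (p.1.1 j₁)
        (p.1.1 i₀ - ((1 - p.2) • p.1.1 j₀ + p.2 • p.1.1 j₁))) := by
  have hc (i : Fin n) : Continuous fun p : {Q : Positions n // Q j₀ ≠ Q j₁} × ℝ => p.1.1 i :=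
    (continuous_apply i).comp (continuous_subtype_val.comp continuous_fst)
  have h0 := hc j₀
  have h1 := hc j₁
  have hi := hc i₀
  have hn (p : {Q : Positions n // Q j₀ ≠ Q j₁} × ℝ) : ‖p.1.1 j₁ - p.1.1 j₀‖ ≠ 0 :=
    norm_ne_zero_iff.2 (sub_ne_zero.2 p.1.2.symm)
  have hu := h1.sub h0
  have hx : Continuous fun p : {Q : Positions n // Q j₀ ≠ Q j₁} × ℝ =>
      p.1.1 i₀ - ((1 - p.2) • p.1.1 j₀ + p.2 • p.1.1 j₁) :=
    hi.sub (((continuous_const.sub continuous_snd).smul h0).add (continuous_snd.smul h1))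
  exact hN.contDiff.continuous.comp
    (((hu.inner hx).div hu.norm hn).prodMk ((continuous_det₂ hu hx).div hu.norm hn))

/-- With the edge parametrized by the fixed interval [0, 1], this is an infimum over a compact set
of a jointly continuous function. Nondegeneracy of the edge is needed for the frame. -/
theorem continuousOn_regDist (hN : IsOneNormEstimate N) (i₀ j₀ j₁ : Fin n) :
    ContinuousOn (fun Q : Positions n => regDist N Q i₀ j₀ j₁) {Q | Q j₀ ≠ Q j₁} := by
  rw [continuousOn_iff_continuous_domRestrict]
  have := (isCompact_Icc (a := (0 : ℝ)) (b := 1)).continuous_sInf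
    (f := fun (Q : {Q : Positions n // Q j₀ ≠ Q j₁}) (θ : ℝ) =>
      N (edgeFrameCoords (Q.1 j₀) (Q.1 j₁) (Q.1 i₀ - ((1 - θ) • Q.1 j₀ + θ • Q.1 j₁))))
    (continuous_frame_family hN i₀ j₀ j₁)
  refine this.congr fun Q => ?_
  rw [Set.domRestrict_apply, regDist_eq]

theorem isOpen_setOf_ne (j₀ j₁ : Fin n) : IsOpen {Q : Positions n | Q j₀ ≠ Q j₁} :=
  isOpen_ne_fun (continuous_apply j₀) (continuous_apply j₁)

theorem regDist_pos (hN : IsOneNormEstimate N) {i₀ j₀ j₁ : Fin n} (hne : Q j₀ ≠ Q j₁)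
    (h : Q i₀ ∉ convexHull ℝ {Q j₀, Q j₁}) : 0 < regDist N Q i₀ j₀ j₁ := by
  have hcont : Continuous fun θ : ℝ => N (edgeFrameCoords (Q j₀) (Q j₁)
      (Q i₀ - ((1 - θ) • Q j₀ + θ • Q j₁))) :=
    (continuous_frame_family hN i₀ j₀ j₁).comp
      (continuous_const.prodMk continuous_id : Continuous fun θ : ℝ =>
        ((⟨Q, hne⟩ : {Q : Positions n // Q j₀ ≠ Q j₁}), θ))
  have hmem := ((isCompact_Icc (a := (0 : ℝ)) (b := 1)).image hcont).sInf_mem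
    ((Set.nonempty_Icc.2 zero_le_one).image _)
  rw [← regDist_eq] at hmem
  obtain ⟨θ, hθ, hθe⟩ := hmem
  rw [← hθe]
  refine hN.pos _ fun h0 => h ?_
  rw [convexHull_pair, segment_eq_image]
  exact ⟨θ, hθ, (sub_eq_zero.1 (eq_zero_of_edgeFrameCoords_eq_zero hne h0)).symm⟩

theorem mem_boundaryEdges {e : Fin n × Fin n} : e ∈ boundaryEdges T ↔
    IsBoundaryEdge Δ {e.1, e.2} ∧ ∃ k ℓ, T.vert k ℓ = e.1 ∧ T.vert k (ℓ + 1) = e.2 := by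
  simp [boundaryEdges]

theorem mem_boundaryVertices {i : Fin n} : i ∈ boundaryVertices Δ ↔ IsBoundaryVertex Δ i := by
  simp [boundaryVertices]

theorem fst_ne_snd_of_mem_boundaryEdges {e : Fin n × Fin n} (he : e ∈ boundaryEdges T) :
    e.1 ≠ e.2 := by
  intro h
  have := (mem_boundaryEdges.1 he).1.2.1
  rw [h] at this
  simp at this

theorem vertex_ne_vertex (hA : ∀ k, 0 < signedArea Q (T.vert k)) {k : Fin NT} {i j : Fin n}
    (hi : i ∈ T.tri k) (hj : j ∈ T.tri k) (hij : i ≠ j) : Q i ≠ Q j := by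
  intro h
  have h1 := weight_unique_of_subset_tri (hA k) (isWeight_single hi) (isWeight_single hj)
    (by rw [sum_single_smul, sum_single_smul, h])
  have := congrFun h1 i
  simp [hij] at this

theorem boundaryEdge_nondegenerate (hA : ∀ k, 0 < signedArea Q (T.vert k)) {e : Fin n × Fin n}
    (he : e ∈ boundaryEdges T) : Q e.1 ≠ Q e.2 := by
  have hne := fst_ne_snd_of_mem_boundaryEdges he
  obtain ⟨-, k, ℓ, h1, h2⟩ := mem_boundaryEdges.1 he
  exact vertex_ne_vertex hA (h1 ▸ T.vert_mem_tri k ℓ) (h2 ▸ T.vert_mem_tri k (ℓ + 1)) hne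

theorem regDist_pos_of_admissible (hN : IsOneNormEstimate N) (hQ : Q ∈ admissibleMeshes T)
    {e : Fin n × Fin n} (he : e ∈ boundaryEdges T) {i : Fin n} (h1 : i ≠ e.1) (h2 : i ≠ e.2) :
    0 < regDist N Q i e.1 e.2 := by
  refine regDist_pos hN (boundaryEdge_nondegenerate hQ.2 he) fun hmem => ?_
  have hd := hQ.1.facesDisjoint {i} (Δ.singleton_mem i) {e.1, e.2} (mem_boundaryEdges.1 he).1.1
    (by simp [h1, h2])
  refine Set.disjoint_left.1 hd (subset_convexHull ℝ _
    (Set.mem_image_of_mem Q (Finset.mem_coe.2 (Finset.mem_singleton_self i)))) ?_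
  simpa [Set.image_pair] using hmem

theorem boundarySeparated_of_regDist_pos (hΔ : IsConnectivityComplex Δ) (hN : IsOneNormEstimate N)
    (h : ∀ e ∈ boundaryEdges T, ∀ i ∈ boundaryVertices Δ, i ≠ e.1 → i ≠ e.2 →
      0 < regDist N Q i e.1 e.2) : BoundarySeparated Δ Q := by
  intro e v he hv hve hmem
  obtain ⟨k, hk⟩ := T.exists_subset_tri hΔ he.1
  obtain ⟨ℓ, rfl⟩ := T.exists_eq_pair hk he.2.1
  -- The edge opposite vertex `ℓ` starts at `ℓ + 1` in the triangle's orientation, as membership in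
  -- `boundaryEdges` requires.
  have hℓ : ℓ + 2 = ℓ + 1 + 1 := by rw [add_assoc]; rfl
  have hpos := h (T.vert k (ℓ + 1), T.vert k (ℓ + 2))
    (mem_boundaryEdges.2 ⟨he, k, ℓ + 1, rfl, by rw [hℓ]⟩) v (mem_boundaryVertices.2 hv)
    (by rintro rfl; simp at hve) (by rintro rfl; simp at hve)
  rw [regDist_eq_zero hN (by simpa [Set.image_pair] using hmem)] at hpos
  exact lt_irrefl _ hpos

/-! ### Continuity of the penalty and of the augmentation function -/

theorem NT_pos (hΔ : IsConnectivityComplex Δ) (T : OrientedTriangles Δ NT) : 0 < NT := by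
  obtain ⟨σ, hσ⟩ := hΔ.nonempty
  obtain ⟨k, -⟩ := T.exists_subset_tri hΔ hσ
  exact k.pos

theorem sum_signedArea_pos (hΔ : IsConnectivityComplex Δ) (hQ : Q ∈ admissibleMeshes T) :
    0 < ∑ k, signedArea Q (T.vert k) :=
  Finset.sum_pos (fun k _ => hQ.2 k) ⟨⟨0, NT_pos hΔ T⟩, Finset.mem_univ _⟩

@[fun_prop]
theorem continuous_edgeLength (t : Fin 3 → Fin n) (ℓ : Fin 3) :
    Continuous fun Q : Positions n => edgeLength Q t ℓ := by
  unfold edgeLength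
  fun_prop

theorem edgeLength_pos {k : Fin NT} (hA : ∀ k, 0 < signedArea Q (T.vert k)) (ℓ : Fin 3) :
    0 < edgeLength Q (T.vert k) ℓ := by
  refine norm_pos_iff.2 (sub_ne_zero.2 (vertex_ne_vertex hA (T.vert_mem_tri k _)
    (T.vert_mem_tri k _) fun h => ?_))
  have := T.vert_injective k h
  simp at this

theorem height_pos {k : Fin NT} (hA : ∀ k, 0 < signedArea Q (T.vert k)) (ℓ : Fin 3) :
    0 < height Q (T.vert k) ℓ :=
  div_pos (mul_pos two_pos (hA k)) (edgeLength_pos hA ℓ)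

theorem continuousOn_boundarySum (hN : IsOneNormEstimate N) (c : ℝ) :
    ContinuousOn (boundarySum T N c) (admissibleMeshes T) := by
  unfold boundarySum
  refine continuousOn_finsetSum _ fun e he => continuousOn_finsetSum _ fun i hi => ?_
  rw [Finset.mem_filter] at hi
  refine continuousOn_const.div ((continuousOn_regDist hN i e.1 e.2).mono
    fun Q hQ => boundaryEdge_nondegenerate hQ.2 he) fun Q hQ => ?_
  exact (regDist_pos_of_admissible hN hQ he hi.2.1 hi.2.2).ne'

@[fun_prop]
theorem continuous_frobeniusSq : Continuous fun X : Positions n => frobeniusSq X := by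
  unfold frobeniusSq
  fun_prop

theorem continuousOn_augmentation (hN : IsOneNormEstimate N) (β₁ β₂ β₃ : ℝ) (Qref : Positions n) :
    ContinuousOn (augmentation T N β₁ β₂ β₃ Qref) (admissibleMeshes T) := by
  unfold augmentation
  refine (ContinuousOn.add ?_ (continuousOn_boundarySum hN β₂)).add ?_
  · refine continuousOn_finsetSum _ fun k _ => continuousOn_finsetSum _ fun ℓ _ => ?_
    refine continuousOn_const.div ?_ fun Q hQ => (height_pos hQ.2 ℓ).ne'
    unfold height
    exact ContinuousOn.div (Continuous.continuousOn (by fun_prop))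
      (Continuous.continuousOn (by fun_prop)) fun Q hQ => (edgeLength_pos hQ.2 ℓ).ne'
  · exact Continuous.continuousOn (continuous_const.mul
      (continuous_frobeniusSq.comp (continuous_id.sub continuous_const)))

theorem continuousOn_penalty (hΔ : IsConnectivityComplex Δ) (hN : IsOneNormEstimate N)
    (α₁ α₂ α₃ α₄ : ℝ) (Qref : Positions n) :
    ContinuousOn (penalty T N α₁ α₂ α₃ α₄ Qref) (admissibleMeshes T) := by
  unfold penalty
  refine ((ContinuousOn.add ?_ ?_).add
    (continuousOn_const.mul (continuousOn_boundarySum hN α₃))).add ?_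
  · refine continuousOn_finsetSum _ fun k _ => continuousOn_const.mul (continuousOn_const.mul ?_)
    unfold invQuality
    refine ContinuousOn.div (Continuous.continuousOn (by fun_prop))
      (Continuous.continuousOn (by fun_prop)) fun Q hQ => ?_
    have := hQ.2 k
    positivity
  · exact continuousOn_const.div (Continuous.continuousOn (by fun_prop))
      fun Q hQ => (sum_signedArea_pos hΔ hQ).ne'
  · exact Continuous.continuousOn (continuous_const.mul
      (continuous_frobeniusSq.comp (continuous_id.sub continuous_const)))

theorem boundarySum_nonneg (hN : IsOneNormEstimate N) {c : ℝ} (hc : 0 ≤ c) (Q : Positions n) :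
    0 ≤ boundarySum T N c Q :=
  Finset.sum_nonneg fun _ _ => Finset.sum_nonneg fun _ _ => div_nonneg hc (regDist_nonneg hN _ _ _ _)

theorem frobeniusSq_nonneg (X : Positions n) : 0 ≤ frobeniusSq X :=
  Finset.sum_nonneg fun _ _ => Finset.sum_nonneg fun _ _ => sq_nonneg _

theorem augmentation_nonneg (hN : IsOneNormEstimate N) {β₁ β₂ β₃ : ℝ} (h₁ : 0 < β₁) (h₂ : 0 < β₂)
    (h₃ : 0 < β₃) (Qref : Positions n) (hQ : Q ∈ admissibleMeshes T) :
    0 ≤ augmentation T N β₁ β₂ β₃ Qref Q := by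
  have h1 : 0 ≤ ∑ k, ∑ ℓ, β₁ / height Q (T.vert k) ℓ :=
    Finset.sum_nonneg fun k _ => Finset.sum_nonneg fun ℓ _ => (div_pos h₁ (height_pos hQ.2 ℓ)).le
  have h2 := boundarySum_nonneg (T := T) hN h₂.le Q
  have h3 := frobeniusSq_nonneg (Q - Qref)
  unfold augmentation
  positivity

theorem invQuality_nonneg {t : Fin 3 → Fin n} (hA : 0 < signedArea Q t) : 0 ≤ invQuality Q t := by
  unfold invQuality
  positivity

/-- The four nonnegative parts of the penalty function are bounded by its value. -/
theorem penalty_parts_le (hΔ : IsConnectivityComplex Δ) (hN : IsOneNormEstimate N)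
    {α₁ α₂ α₃ α₄ b : ℝ} (h₁ : 0 < α₁) (h₂ : 0 < α₂) (h₃ : 0 < α₃) (h₄ : 0 < α₄) {Qref : Positions n}
    (hQ : Q ∈ admissibleMeshes T) (hb : penalty T N α₁ α₂ α₃ α₄ Qref Q ≤ b) :
    (∀ k, 1 / (NT : ℝ) * (α₁ * invQuality Q (T.vert k)) ≤ b) ∧
      α₂ / (∑ k, signedArea Q (T.vert k)) ≤ b ∧
      1 / (((boundaryEdges T).card : ℝ) * ((boundaryVertices Δ).card : ℝ)) *
        boundarySum T N α₃ Q ≤ b ∧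
      α₄ / 2 * frobeniusSq (Q - Qref) ≤ b := by
  have hq (k : Fin NT) : 0 ≤ 1 / (NT : ℝ) * (α₁ * invQuality Q (T.vert k)) := by
    have := invQuality_nonneg (hQ.2 k)
    positivity
  have p1 := Finset.sum_nonneg fun k (_ : k ∈ Finset.univ) => hq k
  have p2 := div_nonneg h₂.le (sum_signedArea_pos hΔ hQ).le
  have p3 : 0 ≤ 1 / (((boundaryEdges T).card : ℝ) * ((boundaryVertices Δ).card : ℝ)) *
      boundarySum T N α₃ Q := mul_nonneg (by positivity) (boundarySum_nonneg hN h₃.le Q)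
  have p4 : 0 ≤ α₄ / 2 * frobeniusSq (Q - Qref) := mul_nonneg (by positivity) (frobeniusSq_nonneg _)
  unfold penalty at hb
  refine ⟨fun k => ?_, by linarith, by linarith, by linarith⟩
  have := Finset.single_le_sum (fun k _ => hq k) (Finset.mem_univ k)
  linarith

/-! ### Lower bounds on sublevel sets -/

theorem regDist_ge_of_penalty_le (hΔ : IsConnectivityComplex Δ) (hN : IsOneNormEstimate N)
    {α₁ α₂ α₃ α₄ : ℝ} (b : ℝ) (h₁ : 0 < α₁) (h₂ : 0 < α₂) (h₃ : 0 < α₃) (h₄ : 0 < α₄)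
    (Qref : Positions n) :
    ∃ c, 0 < c ∧ ∀ Q ∈ admissibleMeshes T, penalty T N α₁ α₂ α₃ α₄ Qref Q ≤ b →
      ∀ e ∈ boundaryEdges T, ∀ i ∈ boundaryVertices Δ, i ≠ e.1 → i ≠ e.2 →
        c ≤ regDist N Q i e.1 e.2 := by
  -- `M` bounds the boundary sum with numerator `α₃`; the extra 1 keeps it positive when `b = 0` or
  -- there is no boundary edge.
  set M : ℝ := |b| * (((boundaryEdges T).card : ℝ) * ((boundaryVertices Δ).card : ℝ)) + 1 with hM
  have hMpos : 0 < M := by positivity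
  refine ⟨α₃ / M, by positivity, fun Q hQ hb e he i hi hi1 hi2 => ?_⟩
  have hb3 := (penalty_parts_le hΔ hN h₁ h₂ h₃ h₄ hQ hb).2.2.1
  have hE : (0 : ℝ) < (boundaryEdges T).card := by exact_mod_cast Finset.card_pos.2 ⟨e, he⟩
  have hV : (0 : ℝ) < (boundaryVertices Δ).card := by exact_mod_cast Finset.card_pos.2 ⟨i, hi⟩
  rw [one_div, inv_mul_le_iff₀ (by positivity)] at hb3
  have hterm : α₃ / regDist N Q i e.1 e.2 ≤ boundarySum T N α₃ Q := by
    have hnn (e : Fin n × Fin n) (i : Fin n) : 0 ≤ α₃ / regDist N Q i e.1 e.2 :=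
      div_nonneg h₃.le (regDist_nonneg hN _ _ _ _)
    unfold boundarySum
    refine le_trans ?_ (Finset.single_le_sum
      (fun e _ => Finset.sum_nonneg fun i _ => hnn e i) he)
    exact Finset.single_le_sum (f := fun i => α₃ / regDist N Q i e.1 e.2) (fun i _ => hnn e i)
      (Finset.mem_filter.2 ⟨hi, hi1, hi2⟩)
  have hd := regDist_pos_of_admissible hN hQ he hi1 hi2
  rw [div_le_iff₀ hd] at hterm
  rw [div_le_iff₀ hMpos]
  have : boundarySum T N α₃ Q ≤ M := by
    have := mul_le_mul_of_nonneg_left (le_abs_self b) (mul_pos hE hV).le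
    rw [hM]
    linarith
  calc α₃ ≤ boundarySum T N α₃ Q * regDist N Q i e.1 e.2 := hterm
    _ ≤ M * regDist N Q i e.1 e.2 := mul_le_mul_of_nonneg_right this hd.le
    _ = _ := mul_comm _ _

/-! ### Comparison of triangle areas. -/

theorem four_mul_signedArea_sq_le (Q : Positions n) (t : Fin 3 → Fin n) (ℓ : Fin 3) :
    4 * signedArea Q t ^ 2 ≤ edgeLength Q t ℓ ^ 2 * edgeLength Q t (ℓ + 1) ^ 2 := by
  -- Any two cyclically consecutive edge vectors span the same determinant; discarding the inner
  -- product in Lagrange's identity gives the bound.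
  have h1 : 2 * signedArea Q t =
      det₂ (Q (t (ℓ + 1)) - Q (t (ℓ + 2))) (Q (t (ℓ + 1 + 1)) - Q (t (ℓ + 1 + 2))) := by
    fin_cases ℓ <;>
    · simp only [signedArea, det₂_eq, PiLp.sub_apply, Fin.isValue]
      simp only [Fin.reduceAdd, Fin.isValue, Fin.zero_eta, Fin.mk_one, Fin.reduceFinMk]
      ring
  have h2 := inner_sq_add_det₂_sq (Q (t (ℓ + 1)) - Q (t (ℓ + 2)))
    (Q (t (ℓ + 1 + 1)) - Q (t (ℓ + 1 + 2)))
  have h3 : 4 * signedArea Q t ^ 2 = (2 * signedArea Q t) ^ 2 := by ring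
  rw [h3, h1, edgeLength, edgeLength, ← h2]
  linarith [sq_nonneg ⟪Q (t (ℓ + 1)) - Q (t (ℓ + 2)), Q (t (ℓ + 1 + 1)) - Q (t (ℓ + 1 + 2))⟫]

/-- In shape regular meshes the areas of edge adjacent triangles are comparable. -/
theorem signedArea_le_of_common_edge {C : ℝ} (hC : 0 < C) (hA : ∀ k, 0 < signedArea Q (T.vert k))
    (hE : ∀ k ℓ, edgeLength Q (T.vert k) ℓ ^ 2 ≤ C * signedArea Q (T.vert k)) {k k' : Fin NT}
    (h : (T.tri k ∩ T.tri k').card = 2) :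
    4 / C ^ 2 * signedArea Q (T.vert k) ≤ signedArea Q (T.vert k') := by
  obtain ⟨ℓ, hℓ⟩ := T.exists_eq_pair Finset.inter_subset_left h
  obtain ⟨ℓ', hℓ'⟩ := T.exists_eq_pair Finset.inter_subset_right h
  have heq : edgeLength Q (T.vert k) ℓ = edgeLength Q (T.vert k') ℓ' := by
    have h' := congrArg (fun s : Finset (Fin n) => (s : Set (Fin n))) (hℓ.symm.trans hℓ')
    simp only [Finset.coe_pair] at h'
    rcases Set.pair_eq_pair_iff.1 h' with ⟨e1, e2⟩ | ⟨e1, e2⟩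
    · rw [edgeLength, edgeLength, e1, e2]
    · rw [edgeLength, edgeLength, e1, e2, norm_sub_rev]
  have h1 := four_mul_signedArea_sq_le Q (T.vert k) ℓ
  have h2 := hE k (ℓ + 1)
  have h3 := hE k' ℓ'
  rw [← heq] at h3
  have hAk := hA k
  -- One factor of the area cancels from 4A² ≤ E² · CA. With E² ≤ CA' on the neighbouring triangle
  -- this becomes 4A ≤ C²A'.
  have h4 : 4 * signedArea Q (T.vert k) ≤ C * edgeLength Q (T.vert k) ℓ ^ 2 := by
    have h5 := mul_le_mul_of_nonneg_left h2 (sq_nonneg (edgeLength Q (T.vert k) ℓ))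
    refine le_of_mul_le_mul_right ?_ hAk
    nlinarith
  rw [div_mul_eq_mul_div, div_le_iff₀ (by positivity)]
  nlinarith

/-- Each step along a chain of edge-adjacent triangles costs a factor 4 / C². The resulting `κ`
depends on the chain and `C` but not on the mesh. -/
theorem exists_area_comparison (T : OrientedTriangles Δ NT) {C : ℝ} (hC : 0 < C) (k₀ : Fin NT)
    {σ : Finset (Fin n)} (h : Relation.ReflTransGen (EdgeAdjacent Δ) (T.tri k₀) σ) :
    ∀ k, T.tri k = σ → ∃ κ, 0 < κ ∧ ∀ Q : Positions n, (∀ k, 0 < signedArea Q (T.vert k)) →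
      (∀ k ℓ, edgeLength Q (T.vert k) ℓ ^ 2 ≤ C * signedArea Q (T.vert k)) →
      κ * signedArea Q (T.vert k₀) ≤ signedArea Q (T.vert k) := by
  induction h with
  | refl =>
    intro k hk
    rw [T.tri_injective hk]
    exact ⟨1, one_pos, fun Q _ _ => by rw [one_mul]⟩
  | tail _ hadj ih =>
    intro k hk
    obtain ⟨k', hk'⟩ := T.exists_tri_eq hadj.1
    obtain ⟨κ, hκ, hle⟩ := ih k' hk'
    refine ⟨4 / C ^ 2 * κ, by positivity, fun Q hA hE => ?_⟩
    have hcard := hadj.2.2.2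
    rw [← hk, ← hk'] at hcard
    have h1 := signedArea_le_of_common_edge hC hA hE hcard
    have h2 := mul_le_mul_of_nonneg_left (hle Q hA hE) (by positivity : 0 ≤ 4 / C ^ 2)
    linarith

theorem exists_uniform_area_comparison (hΔ : IsConnectivityComplex Δ) (T : OrientedTriangles Δ NT)
    {C : ℝ} (hC : 0 < C) : ∃ κ, 0 < κ ∧ ∀ Q : Positions n, (∀ k, 0 < signedArea Q (T.vert k)) →
      (∀ k ℓ, edgeLength Q (T.vert k) ℓ ^ 2 ≤ C * signedArea Q (T.vert k)) →
      ∀ k₀ k, κ * signedArea Q (T.vert k₀) ≤ signedArea Q (T.vert k) := by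
  choose κ hκ hle using fun k₀ k => exists_area_comparison T hC k₀
    (hΔ.twoPathConnected _ (T.tri_mem k₀) _ (T.tri_mem k)) k rfl
  -- All sufficiently small positive `c` lie below the finitely many constants `κ k₀ k`.
  have hev : ∀ᶠ c : ℝ in 𝓝[>] 0, (∀ k₀ k, c ≤ κ k₀ k) ∧ 0 < c := by
    refine (eventually_all.2 fun k₀ => eventually_all.2 fun k => ?_).and self_mem_nhdsWithin
    exact nhdsWithin_le_nhds (Iic_mem_nhds (hκ k₀ k))
  obtain ⟨c, hc, hc0⟩ := hev.exists
  exact ⟨c, hc0, fun Q hA hE k₀ k =>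
    (mul_le_mul_of_nonneg_right (hc k₀ k) (hA k₀).le).trans (hle k₀ k Q hA hE)⟩

theorem signedArea_ge_of_penalty_le (hΔ : IsConnectivityComplex Δ) (hN : IsOneNormEstimate N)
    {α₁ α₂ α₃ α₄ : ℝ} (b : ℝ) (h₁ : 0 < α₁) (h₂ : 0 < α₂) (h₃ : 0 < α₃) (h₄ : 0 < α₄)
    (Qref : Positions n) :
    ∃ c, 0 < c ∧ ∀ Q ∈ admissibleMeshes T, penalty T N α₁ α₂ α₃ α₄ Qref Q ≤ b →
      ∀ k, c ≤ signedArea Q (T.vert k) := by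
  have hNT : (0 : ℝ) < NT := by exact_mod_cast NT_pos hΔ T
  -- The quality term bounds `invQuality` by |b| · NT / α₁; clearing its denominator gives this `C`,
  -- with 1 added for positivity.
  set C : ℝ := 4 * √3 * (|b| * NT / α₁) + 1 with hCdef
  have hC : 0 < C := by positivity
  obtain ⟨κ, hκ, hcomp⟩ := exists_uniform_area_comparison hΔ T hC
  -- The total area is at least α₂ / (|b| + 1), and summing the comparison over all triangles bounds
  -- κ times it by NT times any single area.
  refine ⟨κ * (α₂ / (|b| + 1)) / NT, by positivity, fun Q hQ hb k => ?_⟩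
  obtain ⟨hb1, hb2, -, -⟩ := penalty_parts_le hΔ hN h₁ h₂ h₃ h₄ hQ hb
  have hE (k : Fin NT) (ℓ : Fin 3) :
      edgeLength Q (T.vert k) ℓ ^ 2 ≤ C * signedArea Q (T.vert k) := by
    have hA := hQ.2 k
    have hinv : invQuality Q (T.vert k) ≤ |b| * NT / α₁ := by
      have h := (hb1 k).trans (le_abs_self b)
      rw [one_div, inv_mul_le_iff₀ hNT] at h
      rw [le_div_iff₀ h₁]
      linarith
    rw [invQuality, div_le_iff₀ (by positivity)] at hinv
    have hsum : edgeLength Q (T.vert k) ℓ ^ 2 ≤ edgeLength Q (T.vert k) 0 ^ 2 +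
        edgeLength Q (T.vert k) 1 ^ 2 + edgeLength Q (T.vert k) 2 ^ 2 := by
      rw [← Fin.sum_univ_three fun ℓ => edgeLength Q (T.vert k) ℓ ^ 2]
      exact Finset.single_le_sum (f := fun ℓ => edgeLength Q (T.vert k) ℓ ^ 2)
        (fun _ _ => sq_nonneg _) (Finset.mem_univ ℓ)
    rw [hCdef]
    linarith
  have htot : α₂ / (|b| + 1) ≤ ∑ k, signedArea Q (T.vert k) := by
    have hpos := sum_signedArea_pos hΔ hQ
    rw [div_le_iff₀ hpos] at hb2
    rw [div_le_iff₀ (by positivity)]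
    have := mul_le_mul_of_nonneg_right (le_abs_self b) hpos.le
    linarith
  have hsum : κ * ∑ k₀, signedArea Q (T.vert k₀) ≤ NT * signedArea Q (T.vert k) := by
    rw [Finset.mul_sum]
    refine (Finset.sum_le_sum fun k₀ _ => hcomp Q hQ.2 hE k₀ k).trans (by simp)
  rw [div_le_iff₀ hNT]
  have := mul_le_mul_of_nonneg_left htot hκ.le
  linarith

/-! ### Compactness of sublevel sets -/

theorem dist_sq_le_frobeniusSq (Q Q' : Positions n) (i : Fin n) :
    dist (Q i) (Q' i) ^ 2 ≤ frobeniusSq (Q - Q') := by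
  rw [dist_eq_norm, EuclideanSpace.real_norm_sq_eq]
  exact Finset.single_le_sum (f := fun i => ∑ r, ((Q - Q') i r) ^ 2)
    (fun _ _ => Finset.sum_nonneg fun _ _ => sq_nonneg _) (Finset.mem_univ i)

theorem isCompact_sublevel (hΔ : IsConnectivityComplex Δ) (hN : IsOneNormEstimate N)
    {α₁ α₂ α₃ α₄ : ℝ} (b : ℝ) (h₁ : 0 < α₁) (h₂ : 0 < α₂) (h₃ : 0 < α₃) (h₄ : 0 < α₄)
    (Qref : Positions n) :
    IsCompact {Q | Q ∈ planarManifold T Qref ∧ penalty T N α₁ α₂ α₃ α₄ Qref Q ≤ b} := by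
  set S := {Q | Q ∈ planarManifold T Qref ∧ penalty T N α₁ α₂ α₃ α₄ Qref Q ≤ b} with hS
  have hSadm : S ⊆ admissibleMeshes T := fun Q hQ => hQ.1.1
  obtain ⟨c, hc, harea⟩ := signedArea_ge_of_penalty_le (T := T) hΔ hN b h₁ h₂ h₃ h₄ Qref
  obtain ⟨c', hc', hdist⟩ := regDist_ge_of_penalty_le (T := T) hΔ hN b h₁ h₂ h₃ h₄ Qref
  have hclosed : IsClosed S := by
    refine isClosed_of_closure_subset fun Q hQ => ?_
    have hfreq := mem_closure_iff_frequently.1 hQ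
    have hA (k : Fin NT) : 0 < signedArea Q (T.vert k) := by
      have : closure S ⊆ {Q | c ≤ signedArea Q (T.vert k)} :=
        closure_minimal (fun Q' hQ' => harea Q' (hSadm hQ') hQ'.2 k)
          (isClosed_le continuous_const (continuous_signedArea _))
      exact hc.trans_le (this hQ)
    have hD : ∀ e ∈ boundaryEdges T, ∀ i ∈ boundaryVertices Δ, i ≠ e.1 → i ≠ e.2 →
        0 < regDist N Q i e.1 e.2 := by
      intro e he i hi hi1 hi2
      by_contra hneg
      have hcont := (continuousOn_regDist hN i e.1 e.2).continuousAt
        ((isOpen_setOf_ne e.1 e.2).mem_nhds (boundaryEdge_nondegenerate hA he))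
      obtain ⟨Q', hQ', hlt⟩ := (hfreq.and_eventually
        (hcont.eventually (gt_mem_nhds ((not_lt.1 hneg).trans_lt hc')))).exists
      exact hlt.not_ge (hdist Q' (hSadm hQ') hQ'.2 e he i hi hi1 hi2)
    have hI := interiorsDisjoint_of_mem_closure (closure_mono hSadm hQ) hA
    have hadm : Q ∈ admissibleMeshes T :=
      ⟨(facesDisjoint_of_boundarySeparated hΔ hA hI
        (boundarySeparated_of_regDist_pos hΔ hN hD)).isGeometricComplex, hA⟩
    have hnhds := (isOpen_admissibleMeshes T).mem_nhds hadm
    refine ⟨⟨hadm, ?_⟩, ?_⟩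
    -- Inside a ball of admissible meshes the limit is joined to a mesh of `S`, and from there to
    -- `Qref`.
    · obtain ⟨ε, hε, hball⟩ := Metric.mem_nhds_iff.1 hnhds
      obtain ⟨Q', hQ', hQ'b⟩ := (hfreq.and_eventually (Metric.ball_mem_nhds Q hε)).exists
      exact ((((convex_ball Q ε).isPathConnected ⟨Q, Metric.mem_ball_self hε⟩).joinedIn Q
        (Metric.mem_ball_self hε) Q' hQ'b).mono hball).trans hQ'.1.2
    · by_contra hgt
      have hcont := (continuousOn_penalty hΔ hN α₁ α₂ α₃ α₄ Qref).continuousAt hnhds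
      obtain ⟨Q', hQ', hlt⟩ := (hfreq.and_eventually
        (hcont.eventually (lt_mem_nhds (not_le.1 hgt)))).exists
      exact hlt.not_ge hQ'.2
  -- The radius solves α₄ / 2 · r² = b.
  refine Metric.isCompact_of_isClosed_isBounded hclosed
    (Metric.isBounded_closedBall (x := Qref) (r := √(2 * b / α₄)) |>.subset fun Q hQ => ?_)
  have hb4 := (penalty_parts_le hΔ hN h₁ h₂ h₃ h₄ (hSadm hQ) hQ.2).2.2.2
  rw [Metric.mem_closedBall, dist_pi_le_iff (Real.sqrt_nonneg _)]
  intro i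
  refine Real.le_sqrt_of_sq_le ((dist_sq_le_frobeniusSq Q Qref i).trans ?_)
  rw [le_div_iff₀ h₄]
  linarith

end PlanarMesh

theorem theorem3p4 {n NT : ℕ} (Δ : AbstractSimplicialComplex (Fin n))
    (hΔ : PlanarMesh.IsConnectivityComplex Δ) (T : PlanarMesh.OrientedTriangles Δ NT)
    (Qref : PlanarMesh.Positions n) (hQref : Qref ∈ PlanarMesh.admissibleMeshes T)
    (N : ℝ × ℝ → ℝ) (hN : PlanarMesh.IsOneNormEstimate N)
    (α₁ α₂ α₃ α₄ β₁ β₂ β₃ : ℝ)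
    (hα₁ : 0 < α₁) (hα₂ : 0 < α₂) (hα₃ : 0 < α₃) (hα₄ : 0 < α₄)
    (hβ₁ : 0 < β₁) (hβ₂ : 0 < β₂) (hβ₃ : 0 < β₃) :
    (∀ b : ℝ, ∃ B : ℝ, 0 < B ∧
      {Q | Q ∈ PlanarMesh.planarManifold T Qref ∧
          PlanarMesh.penalty T N α₁ α₂ α₃ α₄ Qref Q ≤ b} ⊆
        {Q | Q ∈ PlanarMesh.admissibleMeshes T ∧
          PlanarMesh.augmentation T N β₁ β₂ β₃ Qref Q ∈ Set.Icc 0 B}) ∧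
    IsProperMap (fun Q : PlanarMesh.planarManifold T Qref =>
      PlanarMesh.penalty T N α₁ α₂ α₃ α₄ Qref Q.1) := by

  have hcompact (b : ℝ) := PlanarMesh.isCompact_sublevel (T := T) hΔ hN b hα₁ hα₂ hα₃ hα₄ Qref
  refine ⟨fun b => ?_, ?_⟩
  · have hsub : {Q | Q ∈ PlanarMesh.planarManifold T Qref ∧
        PlanarMesh.penalty T N α₁ α₂ α₃ α₄ Qref Q ≤ b} ⊆ PlanarMesh.admissibleMeshes T :=
      fun Q hQ => hQ.1.1
    obtain ⟨B, hB⟩ := (hcompact b).bddAbove_image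
      ((PlanarMesh.continuousOn_augmentation hN β₁ β₂ β₃ Qref).mono hsub)
    -- The maximum with 1 secures `0 < B`, even when the sublevel set is empty.
    refine ⟨max B 1, lt_max_of_lt_right one_pos, fun Q hQ => ⟨hsub hQ, ?_, ?_⟩⟩
    · exact PlanarMesh.augmentation_nonneg hN hβ₁ hβ₂ hβ₃ Qref (hsub hQ)
    · exact (hB (Set.mem_image_of_mem _ hQ)).trans (le_max_left _ _)
  · have hcont : Continuous fun Q : PlanarMesh.planarManifold T Qref =>
        PlanarMesh.penalty T N α₁ α₂ α₃ α₄ Qref Q.1 :=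
      continuousOn_iff_continuous_domRestrict.1
        ((PlanarMesh.continuousOn_penalty hΔ hN α₁ α₂ α₃ α₄ Qref).mono fun Q hQ => hQ.1)
    refine isProperMap_iff_isCompact_preimage.2 ⟨hcont, fun K hK => ?_⟩
    obtain ⟨b, hb⟩ := hK.bddAbove
    refine IsCompact.of_isClosed_subset (s := (fun Q : PlanarMesh.planarManifold T Qref =>
      PlanarMesh.penalty T N α₁ α₂ α₃ α₄ Qref Q.1) ⁻¹' Set.Iic b) ?_
      (hK.isClosed.preimage hcont) (Set.preimage_mono fun x hx => hb hx)
    -- Compactness in the subspace is compactness of the image in the ambient space, which is the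
    -- sublevel set itself.
    rw [Subtype.isCompact_iff]
    convert hcompact b using 1
    ext Q
    simp [and_comm]
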